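/- Let $m\in\mathbb N\cup\{0\}$. For a smooth regular curve $\gamma:[-1,1]\to\mathbb R^2$ let $s$ be arclength, $\nu$ a smooth unit normal, $k=\langle\gamma_{ss},\nu\rangle$ the curvature, $k_{s^\ell}$ its $\ell$-th arclength derivative and $L$ the length; put $\omega=\frac1{2\pi}\int_\gamma k\,ds$. Let $\eta_\pm$ be two parallel lines at distance $d_0>0$. We say that $\gamma$ satisfies the generalised Neumann boundary conditions if $\gamma(\pm1)\in\eta_\pm$, $\gamma$ meets $\eta_\pm$ orthogonally at $\gamma(\pm 1)$, and $k_{s^{2j+1}}(\pm1)=0$ for $0\le j\le m$. There is a constant $c(m)>0$, depending only on $m$, with the following property. Let $\gamma_0$ be a smooth regular curve (embedded or immersed) which satisfies the generalised Neumann boundary conditions, has $\omega=0$ and length $L_0$, and whose scale-invariant energy is small: $$L_0^{2m+1}\int_{\gamma_0} k_{s^m}^2\,ds\le c(m).$$ Let $0<T\le\infty$ and let $\gamma:[-1,1]\times[0,T)\to\mathbb R^2$ be a smooth solution, consisting of regular curves $\gamma(\cdot,t)$ which satisfy the generalised Neumann boundary conditions with respect to $\eta_\pm$, of the $L^2$-gradient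 flow of $\frac12\int_\gamma k_{s^m}^2\,ds$, $$\frac{\partial\gamma}{\partial t}=\Big[(-1)^{m+1}k_{s^{2m+2}}-\sum_{j=1}^m(-1)^j\,k\,k_{s^{m+j}}k_{s^{m-j}}-\tfrac12\,k\,k_{s^m}^2\Big]\nu,\qquad \gamma(\cdot,0)=\gamma_0 .$$ Then for every $\ell\in\mathbb N\cup\{0\}$ there are a constant $\delta>0$, depending only on $m$, $\ell$ and $L_0$, and a constant $C$, depending only on $m$, $\ell$, $\eta_\pm$ and $\gamma_0$ (not on $T$), such that for all $t\in[0,T)$ $$\int_{\gamma(\cdot,t)}k_{s^\ell}^2\,ds\le C e^{-\delta t}\qquad\text{and}\qquad \|k_{s^\ell}(\cdot,t)\|_\infty\le C e^{-\delta t}.$$ -/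

import Mathlib

namespace CurveFlow

/-- The Euclidean plane. -/
abbrev Plane : Type := EuclideanSpace ℝ (Fin 2)

/-- The parameter interval `[-1, 1]` of the curves. -/
abbrev param : Set ℝ := Set.Icc (-1) 1

/-- The speed `|c'(x)|` of a parametrised curve (one-sided derivatives at `x = ±1`);
the arclength element is `ds = |c'(x)| dx`. -/
noncomputable def speed (c : ℝ → Plane) (x : ℝ) : ℝ :=
  ‖derivWithin c param x‖

/-- The arclength derivative `∂ₛ f = |c'|⁻¹ ∂ₓ f` along the curve `c`. -/
noncomputable def arcDeriv {V : Type*} [NormedAddCommGroup V] [NormedSpace ℝ V]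
    (c : ℝ → Plane) (f : ℝ → V) (x : ℝ) : V :=
  (speed c x)⁻¹ • derivWithin f param x

/-- The unit tangent `τ = ∂ₛ c`. -/
noncomputable def tangent (c : ℝ → Plane) : ℝ → Plane :=
  arcDeriv c c

/-- The unit normal `ν`: the tangent rotated anticlockwise by a right angle. -/
noncomputable def normal (c : ℝ → Plane) (x : ℝ) : Plane :=
  !₂[-(tangent c x 1), tangent c x 0]

/-- The signed curvature `k = ⟨∂ₛ τ, ν⟩`. -/
noncomputable def curvature (c : ℝ → Plane) (x : ℝ) : ℝ :=
  inner ℝ (arcDeriv c (tangent c) x) (normal c x)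

/-- The `n`-th arclength derivative of the curvature. -/
noncomputable def curvDeriv (c : ℝ → Plane) (n : ℕ) : ℝ → ℝ :=
  (arcDeriv c)^[n] (curvature c)

/-- The integral `∫ f ds` along the curve `c`. -/
noncomputable def arcIntegral (c : ℝ → Plane) (f : ℝ → ℝ) : ℝ :=
  ∫ x in (-1 : ℝ)..1, f x * speed c x

/-- The length of the curve. -/
noncomputable def length (c : ℝ → Plane) : ℝ :=
  arcIntegral c (fun _ => 1)

/-- The winding number `(2π)⁻¹ ∫ k ds`. -/
noncomputable def windingNumber (c : ℝ → Plane) : ℝ :=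
  (1 / (2 * Real.pi)) * arcIntegral c (curvature c)

/-- The square of the `L²` norm (in arclength) of the `n`-th arclength derivative of the
curvature. -/
noncomputable def curvEnergy (c : ℝ → Plane) (n : ℕ) : ℝ :=
  arcIntegral c (fun x => curvDeriv c n x ^ 2)

/-- The line `{p : ⟨p, e⟩ = a}`. Lines with the same `e` are parallel; for a unit vector `e` the
lines at levels `a` and `a + d` have distance `|d|`. -/
def line (e : Plane) (a : ℝ) : Set Plane :=
  {p | inner ℝ p e = a}

/-- A smooth regular (immersed) curve whose ends lie on the parallel lines `line e a` and
`line e (a + d)`, meet them orthogonally (the normal `ν` of the curve is orthogonal to the normal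
`e` of the lines), and at which all odd arclength derivatives of the curvature up to order
`2 m + 1` vanish. -/
structure IsNeumannCurve (m : ℕ) (e : Plane) (a d : ℝ) (c : ℝ → Plane) : Prop where
  smooth : ContDiffOn ℝ (⊤ : ℕ∞) c param
  regular : ∀ x ∈ param, derivWithin c param x ≠ 0
  left_mem : c (-1) ∈ line e a
  right_mem : c 1 ∈ line e (a + d)
  left_orthogonal : inner ℝ (normal c (-1)) e = 0
  right_orthogonal : inner ℝ (normal c 1) e = 0
  left_odd : ∀ j ≤ m, curvDeriv c (2 * j + 1) (-1) = 0
  right_odd : ∀ j ≤ m, curvDeriv c (2 * j + 1) 1 = 0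

/-- The normal speed of the `L²`-gradient flow of `½ ∫ (∂ₛᵐ k)² ds`. -/
noncomputable def flowSpeed (m : ℕ) (c : ℝ → Plane) (x : ℝ) : ℝ :=
  (-1) ^ (m + 1) * curvDeriv c (2 * m + 2) x
    - ∑ j ∈ Finset.Icc 1 m,
        (-1) ^ j * (curvature c x * curvDeriv c (m + j) x * curvDeriv c (m - j) x)
    - (1 / 2) * (curvature c x * curvDeriv c m x ^ 2)

/-- The time interval `[0, T)`, where `T = ⊤` is allowed. -/
def timeInterval (T : EReal) : Set ℝ :=
  {t | 0 ≤ t ∧ (t : EReal) < T}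

/-- `γ x t` is a solution on `[-1, 1] × [0, T)`, smooth up to the boundary and up to `t = 0`, of
the `L²`-gradient flow with generalised Neumann boundary conditions and initial curve `γ₀`. -/
structure IsGradientFlow (m : ℕ) (e : Plane) (a d : ℝ) (T : EReal) (γ₀ : ℝ → Plane)
    (γ : ℝ → ℝ → Plane) : Prop where
  time_pos : 0 < T
  smooth : ContDiffOn ℝ (⊤ : ℕ∞) (fun p : ℝ × ℝ => γ p.1 p.2) (param ×ˢ timeInterval T)
  neumann : ∀ t ∈ timeInterval T, IsNeumannCurve m e a d (fun x => γ x t)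
  evolution : ∀ x ∈ param, ∀ t ∈ timeInterval T,
    HasDerivWithinAt (fun r => γ x r)
      (flowSpeed m (fun y => γ y t) x • normal (fun y => γ y t) x) (timeInterval T) t
  initial : ∀ x ∈ param, γ x 0 = γ₀ x

end CurveFlow

/-! Write $\kappa_i=k_{s^i}$ and $E_i=\int\kappa_i^2\,ds$. Along the flow
$\partial_t\kappa_i=(-1)^{m+1}\kappa_{i+2m+4}$ plus cubic and quintic differential polynomials in
$k$ (`timePoly_eq`). Doing this algebra in formal variables keeps every constant dependent on the
polynomial only.

Two structural facts open the way to interpolation. Differentiating the boundary conditions in time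
shows that all odd $\kappa_i$ vanish at the ends (`curvDeriv_eq_zero_of_odd`), so integration by
parts of polynomials with the right parity leaves no boundary terms. Total curvature is conserved,
so $\int k\,ds=0$ and every $\kappa_i$ has a zero; hence Poincaré, $E_i\le L^2E_{i+1}$.

Integration by parts and Cauchy-Schwarz give $E_{i+1}^2\le E_iE_{i+2}$. Choosing $q$ with
$E_n=E_0q^{4n}$, log-convexity yields $E_i\le E_0q^{4i}$ for $i\le n$ (`exists_geomBound`), which
replaces Gagliardo-Nirenberg. With the dimensionless quantity $y=E_0/q^2\le LE_0\le L^{2m+1}E_m$ the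
energy identity becomes $E_l'\le-2E_{l+m+2}+C_l(y+y^2)E_{l+m+2}$ (`exists_energyRate_bound`).

For $l=m$ smallness absorbs the error. The length does not increase either, so a barrier argument
preserves smallness (`scaledEnergy_le`), and Poincaré with $L\le L_0$ gives decay of $E_m$, hence of
$E_0$, at rate $\beta=L_0^{-2(m+2)}$. For other $l$ the constant $C_l$ may beat the threshold, which
must depend on $m$ alone. Then either the error is absorbed, or $y$ is bounded below and $E_{l+m+2}$
is at most a multiple of a power of $E_0$, which already decays (`exists_energyRate_le`). So
$E_l'\le-\beta E_l+Ae^{-\beta t}$, and $E_l$ decays at rate $\beta/2$. The sup bound follows from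
$\kappa_l^2\le LE_{l+1}$. -/

namespace CurveFlow

open MvPolynomial MeasureTheory Set

/-! ### Differential polynomials in the curvature -/

/-- The formal arclength derivative on differential polynomials in the curvature: the variable
`X i` stands for the `i`-th arclength derivative of the curvature. -/
noncomputable def formalD : Derivation ℝ (MvPolynomial ℕ ℝ) (MvPolynomial ℕ ℝ) :=
  mkDerivation ℝ fun i => X (i + 1)

@[simp] lemma formalD_X (i : ℕ) : formalD (X i) = X (i + 1) := by
  simp [formalD, mkDerivation_X]

/-- Differential polynomials which are homogeneous with `μ` factors and total order `N`. -/
noncomputable def diffPoly (μ N : ℕ) : Submodule ℝ (MvPolynomial ℕ ℝ) :=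
  Submodule.span ℝ {p | ∃ s : Multiset ℕ, s.card = μ ∧ s.sum = N ∧ (s.map X).prod = p}

lemma prod_mem_diffPoly (s : Multiset ℕ) :
    ((s.map X).prod : MvPolynomial ℕ ℝ) ∈ diffPoly s.card s.sum :=
  Submodule.subset_span ⟨s, rfl, rfl, rfl⟩

lemma X_mem_diffPoly (i : ℕ) : (X i : MvPolynomial ℕ ℝ) ∈ diffPoly 1 i := by
  simpa using prod_mem_diffPoly {i}

lemma mul_mem_diffPoly {μ N μ' N' : ℕ} {p q : MvPolynomial ℕ ℝ} (hp : p ∈ diffPoly μ N)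
    (hq : q ∈ diffPoly μ' N') : p * q ∈ diffPoly (μ + μ') (N + N') := by
  induction hp using Submodule.span_induction with
  | zero => simp
  | add x y _ _ hx hy => rw [add_mul]; exact add_mem hx hy
  | smul a x _ hx => rw [smul_mul_assoc]; exact Submodule.smul_mem _ _ hx
  | mem x hx =>
    obtain ⟨s, rfl, rfl, rfl⟩ := hx
    induction hq using Submodule.span_induction with
    | zero => simp
    | add x y _ _ hx hy => rw [mul_add]; exact add_mem hx hy
    | smul a x _ hx => rw [mul_smul_comm]; exact Submodule.smul_mem _ _ hx
    | mem x hx =>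
      obtain ⟨s', rfl, rfl, rfl⟩ := hx
      have := prod_mem_diffPoly (s + s')
      simpa using this

lemma mul_mem_diffPoly_of_eq {μ N μ' N' M R : ℕ} {p q : MvPolynomial ℕ ℝ}
    (hp : p ∈ diffPoly μ N) (hq : q ∈ diffPoly μ' N') (hM : μ + μ' = M) (hR : N + N' = R) :
    p * q ∈ diffPoly M R := by
  subst hM hR; exact mul_mem_diffPoly hp hq

lemma formalD_mem_diffPoly {μ N : ℕ} {p : MvPolynomial ℕ ℝ} (hp : p ∈ diffPoly μ N) :
    formalD p ∈ diffPoly μ (N + 1) := by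
  induction hp using Submodule.span_induction with
  | zero => simp
  | add x y _ _ hx hy => rw [map_add]; exact add_mem hx hy
  | smul a x _ hx => rw [Derivation.map_smul]; exact Submodule.smul_mem _ _ hx
  | mem x hx =>
    obtain ⟨s, rfl, rfl, rfl⟩ := hx
    induction s using Multiset.induction with
    | empty => simp
    | cons i s ih =>
      simp only [Multiset.map_cons, Multiset.prod_cons, Derivation.leibniz, formalD_X, smul_eq_mul,
        Multiset.card_cons, Multiset.sum_cons]
      refine add_mem (mul_mem_diffPoly_of_eq (X_mem_diffPoly i) ih (by ring) (by ring)) ?_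
      exact mul_mem_diffPoly_of_eq (prod_mem_diffPoly s) (X_mem_diffPoly (i + 1)) (by ring)
        (by ring)

lemma _root_.Multiset.exists_odd_of_odd_sum (s : Multiset ℕ) (h : Odd s.sum) : ∃ i ∈ s, Odd i := by
  induction s using Multiset.induction with
  | empty => simp at h
  | cons a s ih =>
    rw [Multiset.sum_cons] at h
    by_cases ha : Odd a
    · exact ⟨a, by simp, ha⟩
    · have hs : Odd s.sum := by
        rw [Nat.not_odd_iff_even] at ha
        exact (Nat.odd_add'.1 h).2 ha
      obtain ⟨i, hi, hio⟩ := ih hs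
      exact ⟨i, Multiset.mem_cons_of_mem hi, hio⟩

/-- A differential polynomial of odd total order vanishes where the odd derivatives vanish. -/
lemma aeval_eq_zero_of_odd {μ N : ℕ} {p : MvPolynomial ℕ ℝ} (hp : p ∈ diffPoly μ N) (hN : Odd N)
    {κ : ℕ → ℝ} (hκ : ∀ i ≤ N, Odd i → κ i = 0) : aeval κ p = 0 := by
  induction hp using Submodule.span_induction with
  | zero => simp
  | add x y _ _ hx hy => rw [map_add, hx, hy, add_zero]
  | smul a x _ hx => rw [map_smul, hx, smul_zero]
  | mem x hx =>
    obtain ⟨s, rfl, rfl, rfl⟩ := hx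
    obtain ⟨i, hi, hio⟩ := s.exists_odd_of_odd_sum hN
    rw [map_multiset_prod, Multiset.prod_eq_zero_iff]
    simp only [Multiset.map_map, Multiset.mem_map, Function.comp_apply, aeval_X]
    exact ⟨i, hi, hκ i (Multiset.le_sum_of_mem hi) hio⟩

/-! ### The flow equation in formal variables -/

/-- The terms of `flowSpeed` which are cubic in the curvature. -/
noncomputable def speedCubic (m : ℕ) : MvPolynomial ℕ ℝ :=
  -(∑ j ∈ Finset.Icc 1 m, ((-1 : ℝ) ^ j) • (X 0 * X (m + j) * X (m - j)))
    - (1 / 2 : ℝ) • (X 0 * X m ^ 2)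

/-- The normal speed of the flow as a differential polynomial in the curvature. -/
noncomputable def speedPoly (m : ℕ) : MvPolynomial ℕ ℝ :=
  ((-1 : ℝ) ^ (m + 1)) • X (2 * m + 2) + speedCubic m

lemma speedCubic_mem (m : ℕ) : speedCubic m ∈ diffPoly 3 (2 * m) := by
  refine sub_mem (neg_mem (sum_mem fun j hj => Submodule.smul_mem _ _ ?_))
    (Submodule.smul_mem _ _ ?_)
  · have := (Finset.mem_Icc.1 hj).2
    exact mul_mem_diffPoly_of_eq (mul_mem_diffPoly (X_mem_diffPoly 0) (X_mem_diffPoly (m + j)))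
      (X_mem_diffPoly (m - j)) rfl (by omega)
  · rw [pow_two]
    exact mul_mem_diffPoly_of_eq (X_mem_diffPoly 0)
      (mul_mem_diffPoly (X_mem_diffPoly m) (X_mem_diffPoly m)) rfl (by omega)

/-- The differential polynomial giving the time derivative of `k_{sⁱ}` along the flow. -/
noncomputable def timePoly (m : ℕ) : ℕ → MvPolynomial ℕ ℝ
  | 0 => formalD (formalD (speedPoly m)) + X 0 ^ 2 * speedPoly m
  | i + 1 => formalD (timePoly m i) + X 0 * speedPoly m * X (i + 1)

/-- Scaling explains the shape: each correction trades two derivatives for two more factors. In the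
recursion the commutator term $kF\kappa_{i+1}$ feeds the cubic part through the linear term of the
speed $F$ and the quintic part through its cubic terms. -/
lemma timePoly_eq (m i : ℕ) : ∃ p ∈ diffPoly 3 (i + 2 * m + 2), ∃ q ∈ diffPoly 5 (i + 2 * m),
    timePoly m i = ((-1 : ℝ) ^ (m + 1)) • X (i + 2 * m + 4) + p + q := by
  induction i with
  | zero =>
    refine ⟨formalD (formalD (speedCubic m)) + ((-1 : ℝ) ^ (m + 1)) • (X 0 ^ 2 * X (2 * m + 2)), ?_,
      X 0 ^ 2 * speedCubic m, ?_, ?_⟩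
    · refine add_mem ?_ (Submodule.smul_mem _ _ ?_)
      · have := formalD_mem_diffPoly (formalD_mem_diffPoly (speedCubic_mem m))
        simpa [add_assoc] using this
      · rw [pow_two]
        exact mul_mem_diffPoly_of_eq (mul_mem_diffPoly (X_mem_diffPoly 0) (X_mem_diffPoly 0))
          (X_mem_diffPoly _) rfl (by omega)
    · rw [pow_two]
      exact mul_mem_diffPoly_of_eq (mul_mem_diffPoly (X_mem_diffPoly 0) (X_mem_diffPoly 0))
          (speedCubic_mem m) rfl (by omega)
    · simp only [timePoly, speedPoly, map_add, Derivation.map_smul, formalD_X, mul_add, mul_smul_comm]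
      rw [show 0 + 2 * m + 4 = 2 * m + 2 + 1 + 1 by ring]
      abel
  | succ i ih =>
    obtain ⟨p, hp, q, hq, h⟩ := ih
    refine ⟨formalD p + ((-1 : ℝ) ^ (m + 1)) • (X 0 * X (2 * m + 2) * X (i + 1)), ?_,
      formalD q + X 0 * speedCubic m * X (i + 1), ?_, ?_⟩
    · refine add_mem ?_ (Submodule.smul_mem _ _ ?_)
      · have := formalD_mem_diffPoly hp
        rwa [show i + 2 * m + 2 + 1 = i + 1 + 2 * m + 2 by ring] at this
      · exact mul_mem_diffPoly_of_eq (mul_mem_diffPoly (X_mem_diffPoly 0) (X_mem_diffPoly _))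
          (X_mem_diffPoly _) rfl (by omega)
    · refine add_mem ?_ ?_
      · have := formalD_mem_diffPoly hq
        rwa [show i + 2 * m + 1 = i + 1 + 2 * m by ring] at this
      · exact mul_mem_diffPoly_of_eq (mul_mem_diffPoly (X_mem_diffPoly 0) (speedCubic_mem m))
          (X_mem_diffPoly _) rfl (by omega)
    · simp only [timePoly, h, speedPoly, map_add, Derivation.map_smul, formalD_X, mul_add, add_mul,
        mul_smul_comm, smul_mul_assoc]
      rw [show i + 1 + 2 * m + 4 = i + 2 * m + 4 + 1 by ring]
      abel

/-! ### Weighted integrals on the parameter interval -/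

/-- The integral of `f` over the parameter interval against the line element `v dx`. -/
noncomputable def wInt (v f : ℝ → ℝ) : ℝ := ∫ x in (-1 : ℝ)..1, f x * v x

/-- A line element `v dx` together with a sequence of functions, each of which is the arclength
derivative of its predecessor, the odd ones vanishing at the ends, the first one of mean zero. -/
structure ArcSystem (v : ℝ → ℝ) (κ : ℕ → ℝ → ℝ) : Prop where
  cont : ContinuousOn v param
  pos : ∀ x ∈ param, 0 < v x
  deriv : ∀ i, ∀ x ∈ param, HasDerivWithinAt (κ i) (v x * κ (i + 1) x) param x
  left : ∀ i, Odd i → κ i (-1) = 0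
  right : ∀ i, Odd i → κ i 1 = 0
  mean : wInt v (κ 0) = 0

/-- Evaluation of a differential polynomial. -/
noncomputable def polyEval (κ : ℕ → ℝ → ℝ) (p : MvPolynomial ℕ ℝ) (x : ℝ) : ℝ :=
  aeval (fun i => κ i x) p

/-- The weighted `L²` norms squared. -/
noncomputable def sqInt (v : ℝ → ℝ) (κ : ℕ → ℝ → ℝ) (i : ℕ) : ℝ := wInt v fun x => κ i x ^ 2

lemma hasDerivWithinAt_polyEval {v : ℝ → ℝ} {κ : ℕ → ℝ → ℝ} {s : Set ℝ} {x : ℝ}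
    (h : ∀ i, HasDerivWithinAt (κ i) (v x * κ (i + 1) x) s x) (p : MvPolynomial ℕ ℝ) :
    HasDerivWithinAt (polyEval κ p) (v x * polyEval κ (formalD p) x) s x := by
  induction p using MvPolynomial.induction_on with
  | C a =>
    have h1 : polyEval κ (C a) = fun _ => a := by funext y; simp [polyEval]
    have h2 : formalD (C a) = 0 := by simp
    rw [h1, h2]
    simpa [polyEval] using hasDerivWithinAt_const x s a
  | add p q hp hq =>
    have h1 : polyEval κ (p + q) = fun y => polyEval κ p y + polyEval κ q y := by
      funext y; simp [polyEval]
    rw [h1]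
    refine (hp.add hq).congr_deriv ?_
    simp [polyEval, mul_add]
  | mul_X p i hp =>
    have h1 : polyEval κ (p * X i) = fun y => polyEval κ p y * κ i y := by
      funext y; simp [polyEval]
    rw [h1]
    refine (hp.mul (h i)).congr_deriv ?_
    simp [polyEval]
    ring

lemma wInt_add {v f g : ℝ → ℝ} (hv : ContinuousOn v param) (hf : ContinuousOn f param)
    (hg : ContinuousOn g param) : wInt v (fun x => f x + g x) = wInt v f + wInt v g := by
  unfold wInt
  rw [← intervalIntegral.integral_add]
  · simp only [add_mul]
  · exact ((hf.mul hv).mono (by simp [param])).intervalIntegrable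
  · exact ((hg.mul hv).mono (by simp [param])).intervalIntegrable

lemma wInt_smul (v f : ℝ → ℝ) (a : ℝ) : wInt v (fun x => a * f x) = a * wInt v f := by
  unfold wInt
  rw [← intervalIntegral.integral_const_mul]
  simp only [mul_assoc]

lemma wInt_mono {v f g : ℝ → ℝ} (hv : ContinuousOn v param) (h0 : ∀ x ∈ param, 0 ≤ v x)
    (hf : ContinuousOn f param) (hg : ContinuousOn g param) (h : ∀ x ∈ param, f x ≤ g x) :
    wInt v f ≤ wInt v g := by
  unfold wInt
  refine intervalIntegral.integral_mono_on (by norm_num)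
    ((hf.mul hv).mono (by simp [param])).intervalIntegrable
    ((hg.mul hv).mono (by simp [param])).intervalIntegrable fun x hx => ?_
  exact mul_le_mul_of_nonneg_right (h x hx) (h0 x hx)

lemma wInt_nonneg {v f : ℝ → ℝ} (h0 : ∀ x ∈ param, 0 ≤ v x) (h : ∀ x ∈ param, 0 ≤ f x) :
    0 ≤ wInt v f :=
  intervalIntegral.integral_nonneg (by norm_num) fun x hx => mul_nonneg (h x hx) (h0 x hx)

lemma abs_wInt_le {v f : ℝ → ℝ} (h0 : ∀ x ∈ param, 0 ≤ v x) :
    |wInt v f| ≤ wInt v fun x => |f x| := by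
  refine (intervalIntegral.abs_integral_le_integral_abs (by norm_num)).trans (le_of_eq ?_)
  refine intervalIntegral.integral_congr fun x hx => ?_
  rw [uIcc_of_le (by norm_num)] at hx
  simp only [abs_mul, abs_of_nonneg (h0 x hx)]

lemma wInt_mul_sq_le {v f g : ℝ → ℝ} (hv : ContinuousOn v param) (h0 : ∀ x ∈ param, 0 ≤ v x)
    (hf : ContinuousOn f param) (hg : ContinuousOn g param) :
    wInt v (fun x => f x * g x) ^ 2 ≤ wInt v (fun x => f x ^ 2) * wInt v (fun x => g x ^ 2) := by
  have key : ∀ r : ℝ, 0 ≤ wInt v (fun x => g x ^ 2) * (r * r)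
      + 2 * wInt v (fun x => f x * g x) * r + wInt v (fun x => f x ^ 2) := by
    intro r
    have h1 : 0 ≤ wInt v fun x => (f x + r * g x) ^ 2 :=
      wInt_nonneg h0 fun x _ => sq_nonneg _
    have h2 : (fun x => (f x + r * g x) ^ 2)
        = fun x => (f x ^ 2 + (2 * r) * (f x * g x)) + (r * r) * g x ^ 2 := by
      funext x; ring
    rw [h2, wInt_add hv (by fun_prop) (by fun_prop), wInt_add hv (by fun_prop) (by fun_prop),
      wInt_smul, wInt_smul] at h1
    linarith
  have := discrim_le_zero key
  rw [discrim] at this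
  nlinarith

lemma wInt_abs_mul_le {v f g : ℝ → ℝ} (hv : ContinuousOn v param) (h0 : ∀ x ∈ param, 0 ≤ v x)
    (hf : ContinuousOn f param) (hg : ContinuousOn g param) :
    wInt v (fun x => |f x| * |g x|) ≤
      √(wInt v (fun x => f x ^ 2)) * √(wInt v (fun x => g x ^ 2)) := by
  have := wInt_mul_sq_le hv h0 hf.abs hg.abs
  simp only [sq_abs] at this
  rw [← Real.sqrt_mul (wInt_nonneg h0 fun x _ => sq_nonneg _)]
  exact Real.le_sqrt_of_sq_le this

/-! ### Integration by parts, log-convexity and Poincaré inequalities -/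

namespace ArcSystem

variable {v : ℝ → ℝ} {κ : ℕ → ℝ → ℝ}

lemma nonneg (h : ArcSystem v κ) : ∀ x ∈ param, 0 ≤ v x := fun x hx => (h.pos x hx).le

lemma continuousOn (h : ArcSystem v κ) (i : ℕ) : ContinuousOn (κ i) param :=
  fun x hx => (h.deriv i x hx).continuousWithinAt

lemma continuousOn_polyEval (h : ArcSystem v κ) (p : MvPolynomial ℕ ℝ) :
    ContinuousOn (polyEval κ p) param :=
  fun x hx => (hasDerivWithinAt_polyEval (fun i => h.deriv i x hx) p).continuousWithinAt

lemma sqInt_nonneg (h : ArcSystem v κ) (i : ℕ) : 0 ≤ sqInt v κ i :=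
  wInt_nonneg h.nonneg fun _ _ => sq_nonneg _

lemma length_pos (h : ArcSystem v κ) : 0 < wInt v fun _ => 1 := by
  unfold wInt
  simp only [one_mul]
  refine intervalIntegral.intervalIntegral_pos_of_pos_on
    (h.cont.mono (by simp [param])).intervalIntegrable
    (fun x hx => h.pos x (Ioo_subset_Icc_self hx)) (by norm_num)

lemma integral_formalD (h : ArcSystem v κ) (p : MvPolynomial ℕ ℝ) {a b : ℝ} (ha : a ∈ param)
    (hb : b ∈ param) :
    ∫ x in a..b, polyEval κ (formalD p) x * v x = polyEval κ p b - polyEval κ p a := by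
  have hsub : uIcc a b ⊆ param := by
    rw [param, ← uIcc_of_le (by norm_num : (-1 : ℝ) ≤ 1)] at *
    exact uIcc_subset_uIcc ha hb
  refine intervalIntegral.integral_eq_sub_of_hasDeriv_right
    ((h.continuousOn_polyEval p).mono hsub) (fun x hx => ?_)
    (((h.continuousOn_polyEval _).mul h.cont).mono hsub).intervalIntegrable
  have h1 : uIcc a b ∈ nhds x := by
    rw [uIcc]; exact Icc_mem_nhds hx.1 hx.2
  have h2 := hasDerivWithinAt_polyEval (fun i => h.deriv i x (hsub (mem_of_mem_nhds h1))) p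
  rw [mul_comm]
  exact (h2.hasDerivAt (Filter.mem_of_superset h1 hsub)).hasDerivWithinAt

lemma polyEval_eq_zero_left (h : ArcSystem v κ) {μ N : ℕ} {p : MvPolynomial ℕ ℝ}
    (hp : p ∈ diffPoly μ N) (hN : Odd N) : polyEval κ p (-1) = 0 :=
  aeval_eq_zero_of_odd hp hN fun i _ hi => h.left i hi

lemma polyEval_eq_zero_right (h : ArcSystem v κ) {μ N : ℕ} {p : MvPolynomial ℕ ℝ}
    (hp : p ∈ diffPoly μ N) (hN : Odd N) : polyEval κ p 1 = 0 :=
  aeval_eq_zero_of_odd hp hN fun i _ hi => h.right i hi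

/-- Each monomial of odd total order contains an odd derivative, so both boundary values vanish. -/
lemma wInt_formalD (h : ArcSystem v κ) {μ N : ℕ} {p : MvPolynomial ℕ ℝ}
    (hp : p ∈ diffPoly μ N) (hN : Odd N) : wInt v (polyEval κ (formalD p)) = 0 := by
  rw [wInt, h.integral_formalD p (by simp) (by simp), h.polyEval_eq_zero_left hp hN,
    h.polyEval_eq_zero_right hp hN, sub_zero]

lemma wInt_polyEval_add (h : ArcSystem v κ) (p q : MvPolynomial ℕ ℝ) :
    wInt v (polyEval κ (p + q)) = wInt v (polyEval κ p) + wInt v (polyEval κ q) := by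
  rw [← wInt_add h.cont (h.continuousOn_polyEval p) (h.continuousOn_polyEval q)]
  congr 1
  funext x
  simp [polyEval]

lemma wInt_polyEval_smul (a : ℝ) (p : MvPolynomial ℕ ℝ) :
    wInt v (polyEval κ (a • p)) = a * wInt v (polyEval κ p) := by
  rw [← wInt_smul]
  congr 1
  funext x
  simp [polyEval]

/-- Integration by parts. -/
lemma wInt_X_succ_mul (h : ArcSystem v κ) {μ N : ℕ} {p : MvPolynomial ℕ ℝ} {j : ℕ}
    (hp : p ∈ diffPoly μ N) (hN : Odd (j + N)) :
    wInt v (polyEval κ (X (j + 1) * p)) = -wInt v (polyEval κ (X j * formalD p)) := by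
  have h1 := h.wInt_formalD (mul_mem_diffPoly (X_mem_diffPoly j) hp) hN
  have h2 : formalD (X j * p) = X (j + 1) * p + X j * formalD p := by
    rw [Derivation.leibniz, formalD_X, smul_eq_mul, smul_eq_mul]; ring
  rw [h2, h.wInt_polyEval_add] at h1
  linarith

lemma sqInt_eq (i : ℕ) : sqInt v κ i = wInt v (polyEval κ (X i * X i)) := by
  unfold sqInt
  congr 1
  funext x
  simp [polyEval, pow_two]

/-- Each integration by parts moves one derivative across; the boundary product has order $2i+2j+1$
at the first move, which is odd, and the order stays the same afterwards. -/
lemma wInt_X_mul_X (h : ArcSystem v κ) (i j : ℕ) :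
    wInt v (polyEval κ (X i * X (i + 2 * j))) = (-1) ^ j * sqInt v κ (i + j) := by
  induction j generalizing i with
  | zero => simp [sqInt_eq]
  | succ j ih =>
    have h1 := h.wInt_X_succ_mul (j := i + 2 * j + 1) (X_mem_diffPoly i) (by
      rw [Nat.odd_iff]; omega)
    rw [mul_comm, show i + 2 * (j + 1) = i + 2 * j + 1 + 1 by ring, h1, formalD_X, mul_comm,
      show i + 2 * j + 1 = i + 1 + 2 * j by ring, ih, show i + 1 + j = i + (j + 1) by ring]
    ring

/-- Log-convexity: $E_{i+1}=-\int\kappa_i\kappa_{i+2}\,ds$, then Cauchy-Schwarz. -/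
lemma sqInt_succ_sq_le (h : ArcSystem v κ) (i : ℕ) :
    sqInt v κ (i + 1) ^ 2 ≤ sqInt v κ i * sqInt v κ (i + 2) := by
  have h1 := h.wInt_X_mul_X i 1
  have h2 := wInt_mul_sq_le h.cont h.nonneg (h.continuousOn i) (h.continuousOn (i + 2))
  have h3 : polyEval κ (X i * X (i + 2 * 1)) = fun x => κ i x * κ (i + 2) x := by
    funext x; simp [polyEval]
  rw [h3] at h1
  rw [h1] at h2
  simpa [sqInt] using h2

lemma exists_zero_of_wInt_eq_zero (h : ArcSystem v κ) (i : ℕ) (hi : wInt v (κ i) = 0) :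
    ∃ x ∈ param, κ i x = 0 := by
  by_contra! hne
  have hc := h.continuousOn i
  have hconn : IsPreconnected (κ i '' param) := isPreconnected_Icc.image _ hc
  have hord := hconn.ordConnected
  have h0 : (0 : ℝ) ∉ κ i '' param := by
    rintro ⟨x, hx, hx0⟩; exact hne x hx hx0
  have hmem : ∀ x ∈ param, κ i x ∈ κ i '' param := fun x hx => mem_image_of_mem _ hx
  have h1 : (-1 : ℝ) ∈ param := by simp
  have hint : IntervalIntegrable (fun x => κ i x * v x) volume (-1) 1 :=
    ((hc.mul h.cont).mono (by simp [param])).intervalIntegrable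
  rcases lt_or_gt_of_ne (hne (-1) h1) with hneg | hpos
  · have hall : ∀ x ∈ param, κ i x < 0 := fun x hx => by
      by_contra hx0
      exact h0 (hord.out (hmem _ h1) (hmem x hx) ⟨hneg.le, not_lt.1 hx0⟩)
    have := intervalIntegral.intervalIntegral_pos_of_pos_on hint.neg (fun x hx => by
      have hx' := Ioo_subset_Icc_self hx
      have := mul_neg_of_neg_of_pos (hall x hx') (h.pos x hx')
      simpa using this) (by norm_num)
    have h3 : ∫ x in (-1 : ℝ)..1, (-fun x => κ i x * v x) x = -wInt v (κ i) := by
      rw [wInt, ← intervalIntegral.integral_neg]; rfl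
    rw [h3, hi] at this
    simp at this
  · have hall : ∀ x ∈ param, 0 < κ i x := fun x hx => by
      by_contra hx0
      exact h0 (hord.out (hmem x hx) (hmem _ h1) ⟨not_lt.1 hx0, hpos.le⟩)
    have := intervalIntegral.intervalIntegral_pos_of_pos_on hint (fun x hx => by
      have hx' := Ioo_subset_Icc_self hx
      exact mul_pos (hall x hx') (h.pos x hx')) (by norm_num)
    rw [wInt] at hi
    linarith

/-- Odd orders vanish at the ends. A positive even order is the derivative of an odd one, so it has
mean zero, as $k$ itself does; a continuous function of mean zero changes sign or vanishes. -/
lemma exists_zero (h : ArcSystem v κ) (i : ℕ) : ∃ x ∈ param, κ i x = 0 := by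
  rcases Nat.even_or_odd i with he | ho
  · refine h.exists_zero_of_wInt_eq_zero i ?_
    rcases i with _ | i
    · exact h.mean
    · have h1 := h.wInt_formalD (X_mem_diffPoly i) (by
        rw [Nat.odd_iff]; rw [Nat.even_iff] at he; omega)
      have h2 : polyEval κ (formalD (X i)) = κ (i + 1) := by funext x; simp [polyEval]
      rwa [h2] at h1
  · exact ⟨-1, by simp, h.left i ho⟩

/-- A differential polynomial with a zero is bounded by the integral of its derivative. -/
lemma abs_polyEval_le (h : ArcSystem v κ) (p : MvPolynomial ℕ ℝ) {x₀ x : ℝ} (hx₀ : x₀ ∈ param)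
    (h0 : polyEval κ p x₀ = 0) (hx : x ∈ param) :
    |polyEval κ p x| ≤ wInt v fun y => |polyEval κ (formalD p) y| := by
  have h1 := h.integral_formalD p hx₀ hx
  rw [h0, sub_zero] at h1
  rw [← h1]
  have hsub : uIoc x₀ x ⊆ uIoc (-1 : ℝ) 1 := by
    apply uIoc_subset_uIoc_of_uIcc_subset_uIcc
    rw [uIcc_of_le (by norm_num : (-1 : ℝ) ≤ 1)]
    have : uIcc x₀ x ⊆ param := by
      rw [param, ← uIcc_of_le (by norm_num : (-1 : ℝ) ≤ 1)] at *
      exact uIcc_subset_uIcc hx₀ hx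
    exact this
  have hsub' : uIoc x₀ x ⊆ param := by
    refine hsub.trans ?_
    rw [uIoc_of_le (by norm_num)]; exact Ioc_subset_Icc_self
  have hpos : 0 ≤ wInt v fun y => |polyEval κ (formalD p) y| :=
    wInt_nonneg h.nonneg fun _ _ => abs_nonneg _
  rw [← abs_of_nonneg hpos, wInt]
  have h2 : |∫ y in x₀..x, polyEval κ (formalD p) y * v y|
      ≤ |∫ y in x₀..x, |polyEval κ (formalD p) y| * v y| := by
    have h3 := intervalIntegral.norm_integral_le_abs_integral_norm (a := x₀) (b := x)
      (μ := volume) (f := fun y => polyEval κ (formalD p) y * v y)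
    rw [Real.norm_eq_abs] at h3
    refine h3.trans (le_of_eq ?_)
    congr 1
    refine intervalIntegral.integral_congr_ae (Filter.Eventually.of_forall fun y hy => ?_)
    simp only [norm_mul, Real.norm_eq_abs, abs_of_nonneg (h.nonneg y (hsub' hy))]
  refine h2.trans (intervalIntegral.abs_integral_mono_interval hsub ?_ ?_)
  · refine (ae_restrict_iff' measurableSet_uIoc).2 (Filter.Eventually.of_forall fun y hy => ?_)
    rw [uIoc_of_le (by norm_num)] at hy
    exact mul_nonneg (abs_nonneg _) (h.nonneg y (Ioc_subset_Icc_self hy))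
  · exact (((h.continuousOn_polyEval _).abs.mul h.cont).mono (by simp [param])).intervalIntegrable

/-- Integrating $(\kappa_i^2)_s$ from a zero gives a sup bound free of the length, so it fits the
geometric progression exactly. -/
lemma sq_le_two_mul (h : ArcSystem v κ) (i : ℕ) {x : ℝ} (hx : x ∈ param) :
    κ i x ^ 2 ≤ 2 * (√(sqInt v κ i) * √(sqInt v κ (i + 1))) := by
  obtain ⟨x₀, hx₀, h0⟩ := h.exists_zero i
  have h1 := h.abs_polyEval_le (X i * X i) hx₀ (by simp [polyEval, h0]) hx
  have h2 : (fun y => |polyEval κ (formalD (X i * X i)) y|)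
      = fun y => 2 * (|κ i y| * |κ (i + 1) y|) := by
    funext y
    rw [Derivation.leibniz, formalD_X, ← two_smul ℝ]
    simp [polyEval, abs_mul]
  have h3 : |polyEval κ (X i * X i) x| = κ i x ^ 2 := by
    simp [polyEval, pow_two]
  rw [h2, wInt_smul, h3] at h1
  refine h1.trans ?_
  gcongr
  exact wInt_abs_mul_le h.cont h.nonneg (h.continuousOn i) (h.continuousOn (i + 1))

lemma sq_le_length_mul (h : ArcSystem v κ) (i : ℕ) {x : ℝ} (hx : x ∈ param) :
    κ i x ^ 2 ≤ (wInt v fun _ => 1) * sqInt v κ (i + 1) := by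
  obtain ⟨x₀, hx₀, h0⟩ := h.exists_zero i
  have h1 := h.abs_polyEval_le (X i) hx₀ (by simp [polyEval, h0]) hx
  have h2 : (fun y => |polyEval κ (formalD (X i)) y|) = fun y => 1 * |κ (i + 1) y| := by
    funext y
    simp [polyEval]
  have h3 : |polyEval κ (X i) x| = |κ i x| := by simp [polyEval]
  rw [h2, h3] at h1
  have h4 := wInt_mul_sq_le (f := fun _ => 1) (g := fun y => |κ (i + 1) y|) h.cont h.nonneg
    continuousOn_const (h.continuousOn (i + 1)).abs
  simp only [sq_abs, one_pow] at h4
  rw [← sq_abs]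
  exact (pow_le_pow_left₀ (abs_nonneg _) h1 2).trans h4

/-- Poincaré inequality: the sup bound from a zero of $\kappa_i$, integrated once more. -/
lemma sqInt_le (h : ArcSystem v κ) (i : ℕ) :
    sqInt v κ i ≤ (wInt v fun _ => 1) ^ 2 * sqInt v κ (i + 1) := by
  have h1 : sqInt v κ i ≤ wInt v fun _ => ((wInt v fun _ => 1) * sqInt v κ (i + 1)) * 1 :=
    wInt_mono h.cont h.nonneg ((h.continuousOn i).pow 2) continuousOn_const fun x hx => by
      simpa using h.sq_le_length_mul i hx
  rw [wInt_smul] at h1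
  linarith

lemma sqInt_le_pow (h : ArcSystem v κ) (i j : ℕ) :
    sqInt v κ i ≤ (wInt v fun _ => 1) ^ (2 * j) * sqInt v κ (i + j) := by
  induction j with
  | zero => simp
  | succ j ih =>
    refine ih.trans ?_
    have := mul_le_mul_of_nonneg_left (h.sqInt_le (i + j))
      (pow_nonneg h.length_pos.le (2 * j))
    refine this.trans (le_of_eq ?_)
    rw [← add_assoc]
    ring

end ArcSystem

/-! ### Interpolation through a geometric progression -/

/-- Discrete maximum principle for log-convex sequences. -/
lemma le_of_sq_le_mul {b : ℕ → ℝ} {A : ℝ} {n : ℕ} (hb : ∀ i, 0 ≤ b i)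
    (h : ∀ i, b (i + 1) ^ 2 ≤ b i * b (i + 2)) (h0 : b 0 ≤ A) (hn : b n ≤ A) :
    ∀ i ≤ n, b i ≤ A := by
  by_contra! hc
  obtain ⟨j, hj, hjA⟩ := hc
  obtain ⟨M, hM, hmax⟩ := Finset.exists_max_image (Finset.range (n + 1)) b ⟨0, by simp⟩
  -- Take the first index at which the maximum is attained. It is interior, its left neighbour is
  -- strictly smaller and its right neighbour no larger, which contradicts log-convexity.
  have hex : ∃ i, i ≤ n ∧ b i = b M := ⟨M, by simpa [Nat.lt_succ_iff] using hM, rfl⟩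
  classical
  have hfind := Nat.find_spec hex
  have hmin := fun i => Nat.find_min hex (m := i)
  set i := Nat.find hex with hi
  have hMA : A < b M := lt_of_lt_of_le hjA (hmax j (by simp; omega))
  obtain ⟨k, hk⟩ : ∃ k, i = k + 1 := Nat.exists_eq_succ_of_ne_zero (by
    intro h'; rw [h'] at hfind; linarith [hfind.2])
  have hin : i ≠ n := by intro h'; rw [h'] at hfind; linarith [hfind.2]
  rw [hk] at hfind hin hmin
  have h1 : b k < b M := lt_of_le_of_ne (hmax k (by simp; omega)) fun heq =>
    hmin k (by omega) ⟨by omega, heq⟩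
  have h2 : b (k + 2) ≤ b M := hmax (k + 2) (by simp; omega)
  have h3 := h k
  rw [hfind.2] at h3
  have h4 := hb k
  have h5 := hb (k + 2)
  nlinarith

/-- The weighted `L²` norms up to order `n` are controlled by a geometric progression. -/
structure GeomBound (v : ℝ → ℝ) (κ : ℕ → ℝ → ℝ) (n : ℕ) (a q : ℝ) : Prop where
  nonneg : 0 ≤ a
  pos : 0 < q
  le : ∀ i ≤ n, sqInt v κ i ≤ (a * q ^ (2 * i)) ^ 2

lemma GeomBound.mono {v : ℝ → ℝ} {κ : ℕ → ℝ → ℝ} {n n' : ℕ} {a q : ℝ}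
    (h : GeomBound v κ n a q) (hn : n' ≤ n) : GeomBound v κ n' a q :=
  ⟨h.nonneg, h.pos, fun i hi => h.le i (hi.trans hn)⟩

namespace ArcSystem

variable {v : ℝ → ℝ} {κ : ℕ → ℝ → ℝ}

/-- A log-convex sequence lies below its chord, and $q$ is read off from that chord. Here $q^2$ has
the dimension of an inverse length; $Lq^2\ge1$ is the $n$-fold Poincaré inequality $E_0\le
L^{2n}E_n$ rewritten. -/
lemma exists_geomBound (h : ArcSystem v κ) (n : ℕ) (hn : 1 ≤ n) :
    ∃ q, GeomBound v κ n (√(sqInt v κ 0)) q ∧ 1 ≤ (wInt v fun _ => 1) * q ^ 2 ∧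
      sqInt v κ n = sqInt v κ 0 * q ^ (4 * n) := by
  have hL := h.length_pos
  set L := wInt v fun _ => 1
  rcases (h.sqInt_nonneg 0).eq_or_lt with h0 | h0
  · have hz : ∀ i, sqInt v κ i = 0 := by
      intro i
      induction i with
      | zero => exact h0.symm
      | succ i ih =>
        have := h.sqInt_succ_sq_le i
        rw [ih, zero_mul] at this
        exact pow_eq_zero_iff (two_ne_zero) |>.1 (le_antisymm this (sq_nonneg _))
    -- In the degenerate case all $E_i$ vanish and any positive $q$ with $Lq^2\ge1$ serves.
    refine ⟨√(L⁻¹), ⟨Real.sqrt_nonneg _, Real.sqrt_pos.2 (inv_pos.2 hL), fun i _ => ?_⟩, ?_, ?_⟩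
    · rw [hz]; positivity
    · rw [Real.sq_sqrt (inv_pos.2 hL).le, mul_inv_cancel₀ hL.ne']
    · rw [hz, hz, zero_mul]
  · have h1 := h.sqInt_le_pow 0 n
    rw [zero_add] at h1
    have hn0 : 0 < sqInt v κ n := by
      by_contra hcon
      have : sqInt v κ n = 0 := le_antisymm (not_lt.1 hcon) (h.sqInt_nonneg n)
      rw [this, mul_zero] at h1
      linarith
    set R := sqInt v κ n / sqInt v κ 0
    have hR : 0 < R := div_pos hn0 h0
    set q := R ^ (((4 * n : ℕ) : ℝ)⁻¹)
    have hq : 0 < q := Real.rpow_pos_of_pos hR _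
    have hqn : q ^ (4 * n) = R := Real.rpow_inv_natCast_pow hR.le (by omega)
    have hEn : sqInt v κ n = sqInt v κ 0 * q ^ (4 * n) := by
      rw [hqn, mul_div_cancel₀ _ h0.ne']
    refine ⟨q, ⟨Real.sqrt_nonneg _, hq, ?_⟩, ?_, hEn⟩
    -- $E_i/q^{4i}$ is again log-convex and equals $E_0$ at both $0$ and $n$.
    · have key := le_of_sq_le_mul (b := fun i => sqInt v κ i / q ^ (4 * i)) (A := sqInt v κ 0)
        (n := n) (fun i => div_nonneg (h.sqInt_nonneg i) (by positivity)) (fun i => ?_)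
        (by simp) (le_of_eq (by rw [hEn, mul_div_cancel_right₀ _ (by positivity)]))
      · intro i hi
        have := key i hi
        rw [div_le_iff₀ (by positivity)] at this
        rw [mul_pow, Real.sq_sqrt h0.le, ← pow_mul]
        rwa [show 2 * i * 2 = 4 * i by ring]
      · have hlc := h.sqInt_succ_sq_le i
        rw [div_pow, div_mul_div_comm, ← pow_mul, ← pow_add,
          show 4 * i + 4 * (i + 2) = 4 * (i + 1) * 2 by ring]
        gcongr
    · have h2 : 1 ≤ (L * q ^ 2) ^ (2 * n) := by
        rw [mul_pow, ← pow_mul, show 2 * (2 * n) = 4 * n by ring]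
        rw [hEn] at h1
        have : sqInt v κ 0 * 1 ≤ sqInt v κ 0 * (L ^ (2 * n) * q ^ (4 * n)) := by linarith
        exact le_of_mul_le_mul_left this h0
      by_contra hcon
      have := pow_lt_one₀ (by positivity : 0 ≤ L * q ^ 2) (not_le.1 hcon) (by omega : 2 * n ≠ 0)
      linarith

lemma abs_le_of_geomBound (h : ArcSystem v κ) {n : ℕ} {a q : ℝ} (hb : GeomBound v κ (n + 1) a q)
    {i : ℕ} (hi : i ≤ n) {x : ℝ} (hx : x ∈ param) : |κ i x| ≤ 2 * a * q ^ (2 * i + 1) := by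
  have ha := hb.nonneg
  have hq := hb.pos
  have h1 := h.sq_le_two_mul i hx
  have h2 := Real.sqrt_le_sqrt (hb.le i (by omega))
  have h3 := Real.sqrt_le_sqrt (hb.le (i + 1) (by omega))
  rw [Real.sqrt_sq (by positivity)] at h2 h3
  refine abs_le_of_sq_le_sq (h1.trans ?_) (by positivity)
  calc 2 * (√(sqInt v κ i) * √(sqInt v κ (i + 1)))
      ≤ 2 * ((a * q ^ (2 * i)) * (a * q ^ (2 * (i + 1)))) := by gcongr
    _ = 2 * (a * q ^ (2 * i + 1)) ^ 2 := by ring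
    _ ≤ (2 * a * q ^ (2 * i + 1)) ^ 2 := by nlinarith [sq_nonneg (a * q ^ (2 * i + 1))]

lemma abs_prod_le_of_geomBound (h : ArcSystem v κ) {n : ℕ} {a q : ℝ}
    (hb : GeomBound v κ (n + 1) a q) (s : Multiset ℕ) (hs : ∀ i ∈ s, i ≤ n) {x : ℝ}
    (hx : x ∈ param) :
    |polyEval κ (s.map X).prod x| ≤ (2 * a) ^ s.card * q ^ (2 * s.sum + s.card) := by
  have ha := hb.nonneg
  have hq := hb.pos
  induction s using Multiset.induction with
  | empty => simp [polyEval]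
  | cons i s ih =>
    have h1 := h.abs_le_of_geomBound hb (hs i (by simp)) hx
    have h2 := ih fun j hj => hs j (Multiset.mem_cons_of_mem hj)
    have h3 : polyEval κ ((i ::ₘ s).map X).prod x = κ i x * polyEval κ (s.map X).prod x := by
      simp [polyEval]
    rw [h3, abs_mul, Multiset.card_cons, Multiset.sum_cons]
    calc |κ i x| * |polyEval κ (s.map X).prod x|
        ≤ (2 * a * q ^ (2 * i + 1)) * ((2 * a) ^ s.card * q ^ (2 * s.sum + s.card)) := by gcongr
      _ = (2 * a) ^ (s.card + 1) * q ^ (2 * (i + s.sum) + (s.card + 1)) := by ring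

/-- Two factors are integrated by Cauchy-Schwarz, the other $\mu$ are bounded in sup norm. A sup
norm of order $i$ costs $E_{i+1}$, hence the progression up to $n+1$. -/
lemma abs_wInt_prod_le (h : ArcSystem v κ) {n : ℕ} {a q : ℝ}
    (hb : GeomBound v κ (n + 1) a q) (s : Multiset ℕ) (hs : ∀ i ∈ s, i ≤ n) {μ : ℕ}
    (hcard : s.card = μ + 2) :
    |wInt v (polyEval κ (s.map X).prod)| ≤ 2 ^ μ * (a ^ (μ + 2) * q ^ (2 * s.sum + μ)) := by
  have ha := hb.nonneg
  have hq := hb.pos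
  obtain ⟨i, s₁, rfl⟩ : ∃ i s₁, s = i ::ₘ s₁ := by
    obtain ⟨i, hi⟩ := Multiset.card_pos_iff_exists_mem.1 (by omega : 0 < s.card)
    exact ⟨i, s.erase i, (Multiset.cons_erase hi).symm⟩
  rw [Multiset.card_cons] at hcard
  obtain ⟨j, s₂, rfl⟩ : ∃ i s₂, s₁ = i ::ₘ s₂ := by
    obtain ⟨i, hi⟩ := Multiset.card_pos_iff_exists_mem.1 (by omega : 0 < s₁.card)
    exact ⟨i, s₁.erase i, (Multiset.cons_erase hi).symm⟩
  rw [Multiset.card_cons] at hcard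
  obtain rfl : s₂.card = μ := by omega
  have hi := hs i (by simp)
  have hj := hs j (by simp)
  have hs₂ : ∀ k ∈ s₂, k ≤ n := fun k hk => hs k (by simp [hk])
  have e1 := Real.sqrt_le_sqrt (hb.le i (by omega))
  have e2 := Real.sqrt_le_sqrt (hb.le j (by omega))
  rw [Real.sqrt_sq (by positivity)] at e1 e2
  have hpt : ∀ x ∈ param, |polyEval κ ((i ::ₘ j ::ₘ s₂).map X).prod x| ≤
      ((2 * a) ^ s₂.card * q ^ (2 * s₂.sum + s₂.card)) * (|κ i x| * |κ j x|) := fun x hx => by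
    have h3 : polyEval κ ((i ::ₘ j ::ₘ s₂).map X).prod x
        = polyEval κ (s₂.map X).prod x * (κ i x * κ j x) := by
      simp [polyEval]; ring
    rw [h3, abs_mul, abs_mul]
    exact mul_le_mul_of_nonneg_right (h.abs_prod_le_of_geomBound hb s₂ hs₂ hx) (by positivity)
  have c1 := h.continuousOn i
  have c2 := h.continuousOn j
  calc |wInt v (polyEval κ ((i ::ₘ j ::ₘ s₂).map X).prod)|
      ≤ wInt v fun x => |polyEval κ ((i ::ₘ j ::ₘ s₂).map X).prod x| := abs_wInt_le h.nonneg
    _ ≤ wInt v fun x => ((2 * a) ^ s₂.card * q ^ (2 * s₂.sum + s₂.card)) * (|κ i x| * |κ j x|) :=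
        wInt_mono h.cont h.nonneg (h.continuousOn_polyEval _).abs (by fun_prop) hpt
    _ = ((2 * a) ^ s₂.card * q ^ (2 * s₂.sum + s₂.card)) * wInt v fun x => |κ i x| * |κ j x| :=
        wInt_smul _ _ _
    _ ≤ ((2 * a) ^ s₂.card * q ^ (2 * s₂.sum + s₂.card)) *
          ((a * q ^ (2 * i)) * (a * q ^ (2 * j))) := by
        gcongr
        exact (wInt_abs_mul_le h.cont h.nonneg c1 c2).trans (by gcongr; exacts [e1, e2])
    _ = _ := by
        simp only [Multiset.sum_cons]
        ring

end ArcSystem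

/-! ### Bounds for integrals of differential polynomials -/

/-- The integral of `p` is bounded in terms of the geometric progression which controls the
weighted `L²` norms, with a constant depending on `p` only. -/
def IntBounded (n A B : ℕ) (p : MvPolynomial ℕ ℝ) : Prop :=
  ∃ C : ℝ, 0 ≤ C ∧ ∀ (v : ℝ → ℝ) (κ : ℕ → ℝ → ℝ) (a q : ℝ), ArcSystem v κ →
    GeomBound v κ n a q → |wInt v (polyEval κ p)| ≤ C * (a ^ A * q ^ B)

lemma IntBounded.add {n A B : ℕ} {p r : MvPolynomial ℕ ℝ} (hp : IntBounded n A B p)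
    (hr : IntBounded n A B r) : IntBounded n A B (p + r) := by
  obtain ⟨C, hC, h⟩ := hp
  obtain ⟨C', hC', h'⟩ := hr
  refine ⟨C + C', by positivity, fun v κ a q hs hb => ?_⟩
  rw [hs.wInt_polyEval_add, add_mul]
  exact (abs_add_le _ _).trans (add_le_add (h v κ a q hs hb) (h' v κ a q hs hb))

lemma IntBounded.smul {n A B : ℕ} {p : MvPolynomial ℕ ℝ} (hp : IntBounded n A B p) (b : ℝ) :
    IntBounded n A B (b • p) := by
  obtain ⟨C, hC, h⟩ := hp
  refine ⟨|b| * C, by positivity, fun v κ a q hs hb => ?_⟩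
  rw [ArcSystem.wInt_polyEval_smul, abs_mul, mul_assoc]
  exact mul_le_mul_of_nonneg_left (h v κ a q hs hb) (abs_nonneg b)

lemma IntBounded.zero {n A B : ℕ} : IntBounded n A B 0 := by
  refine ⟨0, le_rfl, fun v κ a q hs hb => ?_⟩
  simp [polyEval, wInt]

lemma intBounded_prod {n μ : ℕ} (s : Multiset ℕ) (hs : ∀ i ∈ s, i ≤ n) (hcard : s.card = μ + 2)
    (hsum : s.sum = 2 * n) :
    IntBounded (n + 1) (μ + 2) (4 * n + μ) ((s.map X).prod) := by
  refine ⟨2 ^ μ, by positivity, fun v κ a q h hb => ?_⟩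
  have := h.abs_wInt_prod_le hb s hs hcard
  rwa [hsum, ← mul_assoc 2 2 n] at this

/-- Induction on the excess $j$ over $n$: integrating by parts lowers it by one and differentiates
the cofactor. The boundary term has order $2n-1$, so it vanishes. At excess zero no factor exceeds
$n$. -/
lemma intBounded_X_mul {n μ j : ℕ} {p : MvPolynomial ℕ ℝ} (hj : j ≤ n)
    (hp : p ∈ diffPoly (μ + 1) (n - j)) :
    IntBounded (n + 1) (μ + 2) (4 * n + μ) (X (n + j) * p) := by
  induction j generalizing p with
  | zero =>
    induction hp using Submodule.span_induction with
    | zero => rw [mul_zero]; exact IntBounded.zero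
    | add x y _ _ hx hy => rw [mul_add]; exact hx.add hy
    | smul a x _ hx => rw [mul_smul_comm]; exact hx.smul a
    | mem x hx =>
      obtain ⟨s, hc, hsum, rfl⟩ := hx
      have : (X (n + 0) * (s.map X).prod : MvPolynomial ℕ ℝ) = ((n ::ₘ s).map X).prod := by simp
      rw [this]
      refine intBounded_prod _ (fun i hi => ?_) (by simp [hc]) (by simp [hsum]; ring)
      rcases Multiset.mem_cons.1 hi with rfl | hi
      · exact le_rfl
      · have := Multiset.le_sum_of_mem hi
        omega
  | succ j ih =>
    have h1 := formalD_mem_diffPoly hp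
    rw [show n - (j + 1) + 1 = n - j by omega] at h1
    obtain ⟨C, hC, h⟩ := ih (by omega) h1
    refine ⟨C, hC, fun v κ a q hs hb => ?_⟩
    rw [← add_assoc, hs.wInt_X_succ_mul hp (by rw [Nat.odd_iff]; omega), abs_neg]
    exact h v κ a q hs hb

/-- As the total order is $2n$, at most one factor can have order above $n$; the excess is then
moved off that factor by parts. -/
lemma intBounded_of_mem {n μ : ℕ} {p : MvPolynomial ℕ ℝ} (hp : p ∈ diffPoly (μ + 2) (2 * n)) :
    IntBounded (n + 1) (μ + 2) (4 * n + μ) p := by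
  induction hp using Submodule.span_induction with
  | zero => exact IntBounded.zero
  | add x y _ _ hx hy => exact hx.add hy
  | smul a x _ hx => exact hx.smul a
  | mem x hx =>
    obtain ⟨s, hc, hsum, rfl⟩ := hx
    by_cases hall : ∀ i ∈ s, i ≤ n
    · exact intBounded_prod s hall hc hsum
    · push Not at hall
      obtain ⟨i, hi, hin⟩ := hall
      have hle := Multiset.le_sum_of_mem hi
      obtain ⟨s, rfl⟩ : ∃ s₁, s = i ::ₘ s₁ := ⟨s.erase i, (Multiset.cons_erase hi).symm⟩
      rw [Multiset.card_cons] at hc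
      rw [Multiset.sum_cons] at hsum
      have h1 := prod_mem_diffPoly s
      rw [show s.card = μ + 1 by omega, show s.sum = n - (i - n) by omega] at h1
      have h2 := intBounded_X_mul (by omega) h1
      rw [show n + (i - n) = i by omega] at h2
      simpa using h2

/-- Quartic and sextic integrals are small multiples of the highest weighted `L²` norm. -/
lemma exists_quartic_sextic_bound {n : ℕ} {p r : MvPolynomial ℕ ℝ}
    (hp : p ∈ diffPoly 4 (2 * (n + 1))) (hr : r ∈ diffPoly 6 (2 * n)) :
    ∃ C : ℝ, 0 ≤ C ∧ ∀ (v : ℝ → ℝ) (κ : ℕ → ℝ → ℝ), ArcSystem v κ →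
      ∃ y, 0 ≤ y ∧ y ≤ (wInt v fun _ => 1) * sqInt v κ 0 ∧
        y ^ (2 * (n + 2)) * sqInt v κ (n + 2) = sqInt v κ 0 ^ (2 * (n + 2) + 1) ∧
        |wInt v (polyEval κ (p + r))| ≤ C * (y + y ^ 2) * sqInt v κ (n + 2) := by
  obtain ⟨C, hC, h⟩ := intBounded_of_mem hp
  obtain ⟨C', hC', h'⟩ := intBounded_of_mem hr
  refine ⟨C + C', by positivity, fun v κ hs => ?_⟩
  obtain ⟨q, hb, hq1, hEn⟩ := hs.exists_geomBound (n + 2) (by omega)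
  have hq := hb.pos
  have hE := hs.sqInt_nonneg 0
  have b1 := h v κ _ q hs hb
  have b2 := h' v κ _ q hs (hb.mono (by omega))
  rw [show 2 + 2 = 2 * 2 by norm_num, pow_mul, Real.sq_sqrt hE] at b1
  rw [show 4 + 2 = 2 * 3 by norm_num, pow_mul, Real.sq_sqrt hE] at b2
  set E := sqInt v κ 0
  have hL := hs.length_pos
  -- The witness $y=E_0/q^2$ is scale invariant. The bound $y\le LE_0$ is $Lq^2\ge1$; the identity
  -- eliminates $q$ between $y$ and $E_{n+2}=E_0q^{4(n+2)}$.
  refine ⟨E / q ^ 2, by positivity, ?_, ?_, ?_⟩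
  · rw [div_le_iff₀ (by positivity)]
    nlinarith
  · rw [hEn, div_pow, ← pow_mul, show 2 * (2 * (n + 2)) = 4 * (n + 2) by ring]
    field_simp
    ring
  · have e1 : E ^ 2 * q ^ (4 * (n + 1) + 2) = (E / q ^ 2) * (E * q ^ (4 * (n + 2))) := by
      field_simp; ring
    have e2 : E ^ 3 * q ^ (4 * n + 4) = (E / q ^ 2) ^ 2 * (E * q ^ (4 * (n + 2))) := by
      field_simp; ring
    rw [e1, ← hEn] at b1
    rw [e2, ← hEn] at b2
    rw [hs.wInt_polyEval_add]
    refine (abs_add_le _ _).trans ((add_le_add b1 b2).trans ?_)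
    have hEn0 := hs.sqInt_nonneg (n + 2)
    have hy : 0 ≤ E / q ^ 2 := by positivity
    set y := E / q ^ 2
    have t1 : 0 ≤ C * (y ^ 2 * sqInt v κ (n + 2)) := by positivity
    have t2 : 0 ≤ C' * (y * sqInt v κ (n + 2)) := by positivity
    linarith

/-- The interpolation bound falls short of $E_0\cdot E_{n+1}$ by a factor $q^2$, which $1\le Lq^2$
supplies at the cost of one length. -/
lemma exists_quartic_bound {n : ℕ} {p : MvPolynomial ℕ ℝ} (hp : p ∈ diffPoly 4 (2 * n)) :
    ∃ C : ℝ, 0 ≤ C ∧ ∀ (v : ℝ → ℝ) (κ : ℕ → ℝ → ℝ), ArcSystem v κ →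
      |wInt v (polyEval κ p)| ≤ C * ((wInt v fun _ => 1) * sqInt v κ 0) * sqInt v κ (n + 1) := by
  obtain ⟨C, hC, h⟩ := intBounded_of_mem hp
  refine ⟨C, hC, fun v κ hs => ?_⟩
  obtain ⟨q, hb, hq1, hEn⟩ := hs.exists_geomBound (n + 1) (by omega)
  have hq := hb.pos
  have hE := hs.sqInt_nonneg 0
  have b1 := h v κ _ q hs hb
  rw [show 2 + 2 = 2 * 2 by norm_num, pow_mul, Real.sq_sqrt hE] at b1
  refine b1.trans ?_
  rw [hEn, mul_assoc]
  set E := sqInt v κ 0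
  set L := wInt v fun _ => 1
  have h0 : 0 ≤ E ^ 2 * q ^ (4 * n + 2) := by positivity
  have : E ^ 2 * q ^ (4 * n + 2) * 1 ≤ E ^ 2 * q ^ (4 * n + 2) * (L * q ^ 2) := by gcongr
  refine mul_le_mul_of_nonneg_left ?_ hC
  calc E ^ 2 * q ^ (4 * n + 2) = E ^ 2 * q ^ (4 * n + 2) * 1 := by ring
    _ ≤ E ^ 2 * q ^ (4 * n + 2) * (L * q ^ 2) := this
    _ = L * E * (E * q ^ (4 * (n + 1))) := by ring

/-! ### Rates of change of the energies and of the length -/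

/-- The differential polynomial whose integral is the time derivative of `∫ k_{sˡ}² ds`. -/
noncomputable def energyRate (m l : ℕ) : MvPolynomial ℕ ℝ :=
  (2 : ℝ) • (X l * timePoly m l) - X 0 * speedPoly m * (X l * X l)

/-- The linear part of the evolution, integrated by parts $m+2$ times, has sign
$(-1)^{m+1}(-1)^{m+2}=-1$ and yields the dissipation; everything else is quartic of order $2(l+m+1)$
or sextic of order $2(l+m)$. -/
lemma exists_energyRate_bound (m l : ℕ) :
    ∃ C : ℝ, 0 ≤ C ∧ ∀ (v : ℝ → ℝ) (κ : ℕ → ℝ → ℝ), ArcSystem v κ →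
      ∃ y, 0 ≤ y ∧ y ≤ (wInt v fun _ => 1) * sqInt v κ 0 ∧
        y ^ (2 * (l + m + 2)) * sqInt v κ (l + m + 2)
          = sqInt v κ 0 ^ (2 * (l + m + 2) + 1) ∧
        wInt v (polyEval κ (energyRate m l)) ≤
          -2 * sqInt v κ (l + m + 2) + C * (y + y ^ 2) * sqInt v κ (l + m + 2) := by
  obtain ⟨p, hp, q, hq, h⟩ := timePoly_eq m l
  have hp4 : (2 : ℝ) • (X l * p) - ((-1 : ℝ) ^ (m + 1)) • (X 0 * X (2 * m + 2) * (X l * X l))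
      ∈ diffPoly 4 (2 * (l + m + 1)) := by
    refine sub_mem (Submodule.smul_mem _ _ ?_) (Submodule.smul_mem _ _ ?_)
    · exact mul_mem_diffPoly_of_eq (X_mem_diffPoly l) hp rfl (by ring)
    · exact mul_mem_diffPoly_of_eq (mul_mem_diffPoly (X_mem_diffPoly 0) (X_mem_diffPoly _))
        (mul_mem_diffPoly (X_mem_diffPoly l) (X_mem_diffPoly l)) rfl (by ring)
  have hp6 : (2 : ℝ) • (X l * q) - X 0 * speedCubic m * (X l * X l)
      ∈ diffPoly 6 (2 * (l + m)) := by
    refine sub_mem (Submodule.smul_mem _ _ ?_) ?_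
    · exact mul_mem_diffPoly_of_eq (X_mem_diffPoly l) hq rfl (by ring)
    · exact mul_mem_diffPoly_of_eq (mul_mem_diffPoly (X_mem_diffPoly 0) (speedCubic_mem m))
        (mul_mem_diffPoly (X_mem_diffPoly l) (X_mem_diffPoly l)) rfl (by ring)
  obtain ⟨C, hC, hb⟩ := exists_quartic_sextic_bound hp4 hp6
  refine ⟨C, hC, fun v κ hs => ?_⟩
  obtain ⟨y, hy0, hyL, hyE, hy⟩ := hb v κ hs
  refine ⟨y, hy0, hyL, hyE, ?_⟩
  have hdec : energyRate m l = (2 * (-1 : ℝ) ^ (m + 1)) • (X l * X (l + 2 * (m + 2)))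
      + (((2 : ℝ) • (X l * p) - ((-1 : ℝ) ^ (m + 1)) • (X 0 * X (2 * m + 2) * (X l * X l)))
        + ((2 : ℝ) • (X l * q) - X 0 * speedCubic m * (X l * X l))) := by
    rw [energyRate, h, speedPoly, show l + 2 * (m + 2) = l + 2 * m + 4 by ring]
    simp only [mul_add, add_mul, mul_smul_comm, smul_mul_assoc]
    module
  have hlead : 2 * (-1 : ℝ) ^ (m + 1) * ((-1) ^ (m + 2) * sqInt v κ (l + (m + 2)))
      = -2 * sqInt v κ (l + m + 2) := by
    have : (-1 : ℝ) ^ (m + 1) * (-1) ^ (m + 2) = -1 := by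
      rw [← pow_add]; exact Odd.neg_one_pow (by rw [Nat.odd_iff]; omega)
    rw [← add_assoc]
    linear_combination 2 * sqInt v κ (l + m + 2) * this
  rw [hdec, hs.wInt_polyEval_add, ArcSystem.wInt_polyEval_smul, hs.wInt_X_mul_X, hlead]
  linarith [le_abs_self (wInt v (polyEval κ
    (((2 : ℝ) • (X l * p) - ((-1 : ℝ) ^ (m + 1)) • (X 0 * X (2 * m + 2) * (X l * X l)))
        + ((2 : ℝ) • (X l * q) - X 0 * speedCubic m * (X l * X l)))))]

/-- The differential polynomial whose integral is the time derivative of the length. -/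
noncomputable def lengthRate (m : ℕ) : MvPolynomial ℕ ℝ := -(X 0 * speedPoly m)

/-- The length changes at rate $-\int kF\,ds$, whose leading part is $-E_{m+1}$ after $m+1$
integrations by parts; the remainder is quartic. -/
lemma exists_lengthRate_bound (m : ℕ) :
    ∃ C : ℝ, 0 ≤ C ∧ ∀ (v : ℝ → ℝ) (κ : ℕ → ℝ → ℝ), ArcSystem v κ →
      wInt v (polyEval κ (lengthRate m)) ≤ -sqInt v κ (m + 1) +
        C * ((wInt v fun _ => 1) * sqInt v κ 0) * sqInt v κ (m + 1) := by
  have hp : -(X 0 * speedCubic m) ∈ diffPoly 4 (2 * m) :=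
    neg_mem (mul_mem_diffPoly_of_eq (X_mem_diffPoly 0) (speedCubic_mem m) rfl (by ring))
  obtain ⟨C, hC, hb⟩ := exists_quartic_bound hp
  refine ⟨C, hC, fun v κ hs => ?_⟩
  have hdec : lengthRate m = (-(-1 : ℝ) ^ (m + 1)) • (X 0 * X (0 + 2 * (m + 1)))
      + -(X 0 * speedCubic m) := by
    rw [lengthRate, speedPoly, show 0 + 2 * (m + 1) = 2 * m + 2 by ring]
    simp only [mul_add, mul_smul_comm]
    module
  have hlead : -(-1 : ℝ) ^ (m + 1) * ((-1) ^ (m + 1) * sqInt v κ (0 + (m + 1)))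
      = -sqInt v κ (m + 1) := by
    have : (-1 : ℝ) ^ (m + 1) * (-1) ^ (m + 1) = 1 := by
      rw [← mul_pow]; norm_num
    rw [zero_add]
    linear_combination -sqInt v κ (m + 1) * this
  rw [hdec, hs.wInt_polyEval_add, ArcSystem.wInt_polyEval_smul, hs.wInt_X_mul_X, hlead]
  linarith [hb v κ hs, le_abs_self (wInt v (polyEval κ (-(X 0 * speedCubic m))))]

/-! ### Space and time derivatives up to the boundary -/

section Calculus

variable {V W : Type*} [NormedAddCommGroup V] [NormedSpace ℝ V]

/-- Smoothness up to the boundary of a function of space and time. -/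
def SmoothOn (J : Set ℝ) (f : ℝ → ℝ → V) : Prop :=
  ContDiffOn ℝ (⊤ : ℕ∞) (fun p : ℝ × ℝ => f p.1 p.2) (param ×ˢ J)

/-- The space derivative. -/
noncomputable def dx (f : ℝ → ℝ → V) (x t : ℝ) : V := derivWithin (fun y => f y t) param x

/-- The time derivative. -/
noncomputable def dt (J : Set ℝ) (f : ℝ → ℝ → V) (x t : ℝ) : V :=
  derivWithin (fun r => f x r) J t

variable {J : Set ℝ} {f : ℝ → ℝ → V}

lemma uniqueDiffOn_param : UniqueDiffOn ℝ param := uniqueDiffOn_Icc (by norm_num)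

lemma interior_rect_nonempty (hi : (interior J).Nonempty) :
    (interior (param ×ˢ J)).Nonempty := by
  rw [interior_prod_eq, param, interior_Icc]
  exact Set.Nonempty.prod ⟨0, by norm_num⟩ hi

lemma convex_rect (hc : Convex ℝ J) : Convex ℝ (param ×ˢ J) := (convex_Icc _ _).prod hc

lemma uniqueDiffOn_rect (hc : Convex ℝ J) (hi : (interior J).Nonempty) :
    UniqueDiffOn ℝ (param ×ˢ J) :=
  uniqueDiffOn_convex (convex_rect hc) (interior_rect_nonempty hi)

lemma SmoothOn.hasFDerivWithinAt (hf : SmoothOn J f) {x t : ℝ} (hx : x ∈ param) (ht : t ∈ J) :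
    HasFDerivWithinAt (fun p : ℝ × ℝ => f p.1 p.2)
      (fderivWithin ℝ (fun p : ℝ × ℝ => f p.1 p.2) (param ×ˢ J) (x, t)) (param ×ˢ J) (x, t) :=
  ((hf.differentiableOn (by simp)) (x, t) ⟨hx, ht⟩).hasFDerivWithinAt

lemma hasDerivWithinAt_slice_left {g : ℝ × ℝ → V} {g' : ℝ × ℝ →L[ℝ] V} {x t : ℝ}
    (ht : t ∈ J) (hg : HasFDerivWithinAt g g' (param ×ˢ J) (x, t)) :
    HasDerivWithinAt (fun y => g (y, t)) (g' (1, 0)) param x := by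
  have h := (hasDerivWithinAt_id x param).prodMk (hasDerivWithinAt_const x param t)
  have hm : MapsTo (fun y => (y, t)) param (param ×ˢ J) := fun _ hy => ⟨hy, ht⟩
  exact hg.comp_hasDerivWithinAt (t := param ×ˢ J) x h hm

lemma hasDerivWithinAt_slice_right {g : ℝ × ℝ → V} {g' : ℝ × ℝ →L[ℝ] V} {x t : ℝ}
    (hx : x ∈ param) (hg : HasFDerivWithinAt g g' (param ×ˢ J) (x, t)) :
    HasDerivWithinAt (fun r => g (x, r)) (g' (0, 1)) J t :=
  hg.comp_hasDerivWithinAt t ((hasDerivWithinAt_const t J x).prodMk (hasDerivWithinAt_id t J))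
    (fun _ hy => ⟨hx, hy⟩ : MapsTo (fun r => (x, r)) J (param ×ˢ J))

lemma SmoothOn.hasDerivWithinAt_dx (hf : SmoothOn J f) {x t : ℝ} (hx : x ∈ param) (ht : t ∈ J) :
    HasDerivWithinAt (fun y => f y t) (dx f x t) param x :=
  (hasDerivWithinAt_slice_left ht
    (hf.hasFDerivWithinAt hx ht)).differentiableWithinAt.hasDerivWithinAt

lemma SmoothOn.hasDerivWithinAt_dt (hf : SmoothOn J f) {x t : ℝ} (hx : x ∈ param) (ht : t ∈ J) :
    HasDerivWithinAt (fun r => f x r) (dt J f x t) J t :=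
  (hasDerivWithinAt_slice_right hx
    (hf.hasFDerivWithinAt hx ht)).differentiableWithinAt.hasDerivWithinAt

lemma SmoothOn.dx_eq (hf : SmoothOn J f) {x t : ℝ} (hx : x ∈ param) (ht : t ∈ J) :
    dx f x t = fderivWithin ℝ (fun p : ℝ × ℝ => f p.1 p.2) (param ×ˢ J) (x, t) (1, 0) :=
  (hasDerivWithinAt_slice_left ht (hf.hasFDerivWithinAt hx ht)).derivWithin
    (uniqueDiffOn_param x hx)

lemma SmoothOn.dt_eq (hu : UniqueDiffOn ℝ J) (hf : SmoothOn J f) {x t : ℝ} (hx : x ∈ param)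
    (ht : t ∈ J) :
    dt J f x t = fderivWithin ℝ (fun p : ℝ × ℝ => f p.1 p.2) (param ×ˢ J) (x, t) (0, 1) :=
  (hasDerivWithinAt_slice_right hx (hf.hasFDerivWithinAt hx ht)).derivWithin (hu t ht)

lemma SmoothOn.fderivWithin (hc : Convex ℝ J) (hi : (interior J).Nonempty) (hf : SmoothOn J f) :
    ContDiffOn ℝ (⊤ : ℕ∞)
      (fderivWithin ℝ (fun p : ℝ × ℝ => f p.1 p.2) (param ×ˢ J)) (param ×ˢ J) :=
  ContDiffOn.fderivWithin hf (uniqueDiffOn_rect hc hi) (by simp)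

lemma SmoothOn.dx (hc : Convex ℝ J) (hi : (interior J).Nonempty) (hf : SmoothOn J f) :
    SmoothOn J (dx f) :=
  ((hf.fderivWithin hc hi).clm_apply contDiffOn_const).congr fun _ hp => hf.dx_eq hp.1 hp.2

lemma SmoothOn.dt (hc : Convex ℝ J) (hi : (interior J).Nonempty) (hf : SmoothOn J f) :
    SmoothOn J (dt J f) :=
  ((hf.fderivWithin hc hi).clm_apply contDiffOn_const).congr fun _ hp =>
    hf.dt_eq (uniqueDiffOn_convex hc hi) hp.1 hp.2

/-- Space and time derivatives commute, up to the boundary. -/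
lemma SmoothOn.dt_dx (hc : Convex ℝ J) (hi : (interior J).Nonempty) (hf : SmoothOn J f)
    {x t : ℝ} (hx : x ∈ param) (ht : t ∈ J) :
    CurveFlow.dt J (CurveFlow.dx f) x t = CurveFlow.dx (CurveFlow.dt J f) x t := by
  have hu := uniqueDiffOn_convex hc hi
  set F := fun p : ℝ × ℝ => f p.1 p.2
  set S := param ×ˢ J
  have hmem : (x, t) ∈ S := ⟨hx, ht⟩
  have hd : HasFDerivWithinAt (_root_.fderivWithin ℝ F S)
      (_root_.fderivWithin ℝ (_root_.fderivWithin ℝ F S) S (x, t)) S (x, t) :=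
    ((hf.fderivWithin hc hi).differentiableOn (by simp) (x, t) hmem).hasFDerivWithinAt
  have hsymm : IsSymmSndFDerivWithinAt ℝ F S (x, t) := by
    refine ContDiffWithinAt.isSymmSndFDerivWithinAt (n := (⊤ : ℕ∞)) (hf (x, t) hmem) ?_
      (uniqueDiffOn_rect hc hi) ?_ hmem
    · simp only [minSmoothness_of_isRCLikeNormedField]
      exact WithTop.coe_le_coe.2 (le_top : (2 : ℕ∞) ≤ ⊤)
    -- Symmetry of the second derivative at a boundary point needs that point in the closure of the
    -- interior, which convexity and nonempty interior provide.
    · rw [(convex_rect hc).closure_interior_eq_closure_of_nonempty_interior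
        (interior_rect_nonempty hi)]
      exact subset_closure hmem
  have h1 : CurveFlow.dt J (CurveFlow.dx f) x t
      = _root_.fderivWithin ℝ (_root_.fderivWithin ℝ F S) S (x, t) (0, 1) (1, 0) := by
    have := (hasDerivWithinAt_slice_right hx hd).clm_apply
      (hasDerivWithinAt_const t J ((1, 0) : ℝ × ℝ))
    have h2 := (this.congr (fun r hr => hf.dx_eq hx hr) (hf.dx_eq hx ht)).derivWithin (hu t ht)
    rw [CurveFlow.dt, h2]
    simp
  have h2 : CurveFlow.dx (CurveFlow.dt J f) x t
      = _root_.fderivWithin ℝ (_root_.fderivWithin ℝ F S) S (x, t) (1, 0) (0, 1) := by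
    have := (hasDerivWithinAt_slice_left ht hd).clm_apply
      (hasDerivWithinAt_const x param ((0, 1) : ℝ × ℝ))
    have h2 := (this.congr (fun r hr => hf.dt_eq hu hr ht) (hf.dt_eq hu hx ht)).derivWithin
      (uniqueDiffOn_param x hx)
    rw [CurveFlow.dx, h2]
    simp
  rw [h1, h2, hsymm]

lemma SmoothOn.continuousOn_left (hf : SmoothOn J f) {t : ℝ} (ht : t ∈ J) :
    ContinuousOn (fun x => f x t) param :=
  fun _ hx => (hf.hasDerivWithinAt_dx hx ht).continuousWithinAt

end Calculus

/-! ### Integrals depending on time -/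

lemma convex_timeInterval (T : EReal) : Convex ℝ (timeInterval T) := by
  have : (timeInterval T).OrdConnected := ⟨fun x hx y hy z hz =>
    ⟨hx.1.trans hz.1, lt_of_le_of_lt (EReal.coe_le_coe_iff.2 hz.2) hy.2⟩⟩
  exact this.convex

/-- Since $[0,T)$ is open on the right, every time lies in a compact window with room beyond it;
there smooth functions have the constant bounds used for dominated convergence. -/
lemma exists_gt_mem_timeInterval {T : EReal} {t : ℝ} (ht : t ∈ timeInterval T) :
    ∃ b, t < b ∧ Icc 0 b ⊆ timeInterval T := by
  obtain ⟨b, h1, h2⟩ := EReal.lt_iff_exists_real_btwn.1 ht.2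
  exact ⟨b, EReal.coe_lt_coe_iff.1 h1, fun s hs =>
    ⟨hs.1, lt_of_le_of_lt (EReal.coe_le_coe_iff.2 hs.2) h2⟩⟩

lemma timeInterval_mem_nhds {T : EReal} {t : ℝ} (ht : t ∈ timeInterval T) (h0 : 0 < t) :
    timeInterval T ∈ nhds t := by
  obtain ⟨b, hb, hsub⟩ := exists_gt_mem_timeInterval ht
  exact Filter.mem_of_superset (Icc_mem_nhds h0 hb) hsub

lemma interior_timeInterval_nonempty {T : EReal} (hT : 0 < T) :
    (interior (timeInterval T)).Nonempty := by
  obtain ⟨b, hb, hsub⟩ := exists_gt_mem_timeInterval (T := T) (t := 0) ⟨le_rfl, by simpa using hT⟩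
  have h := hsub ⟨by linarith, by linarith⟩ (a := b / 2)
  exact ⟨b / 2, mem_interior_iff_mem_nhds.2 (timeInterval_mem_nhds h (by linarith))⟩

lemma SmoothOn.exists_bound {T : EReal} {g : ℝ → ℝ → ℝ} (hg : SmoothOn (timeInterval T) g)
    {b : ℝ} (hb : Icc 0 b ⊆ timeInterval T) :
    ∃ C, ∀ x ∈ param, ∀ t ∈ Icc 0 b, ‖g x t‖ ≤ C := by
  have hK : IsCompact (param ×ˢ Icc 0 b) := isCompact_Icc.prod isCompact_Icc
  obtain ⟨C, hC⟩ := hK.exists_bound_of_continuousOn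
    (hg.continuousOn.mono (prod_mono le_rfl hb))
  exact ⟨C, fun x hx t ht => hC (x, t) ⟨hx, ht⟩⟩

lemma uIoc_subset_param : uIoc (-1 : ℝ) 1 ⊆ param := by
  rw [uIoc_of_le (by norm_num)]; exact Ioc_subset_Icc_self

lemma SmoothOn.aestronglyMeasurable {T : EReal} {g : ℝ → ℝ → ℝ}
    (hg : SmoothOn (timeInterval T) g) {t : ℝ} (ht : t ∈ timeInterval T) :
    AEStronglyMeasurable (fun x => g x t) (volume.restrict (uIoc (-1 : ℝ) 1)) :=
  ((hg.continuousOn_left ht).mono uIoc_subset_param).aestronglyMeasurable measurableSet_uIoc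

lemma SmoothOn.continuousOn_integral {T : EReal} {g : ℝ → ℝ → ℝ}
    (hg : SmoothOn (timeInterval T) g) :
    ContinuousOn (fun t => ∫ x in (-1 : ℝ)..1, g x t) (timeInterval T) := by
  intro t ht
  obtain ⟨b, hb, hsub⟩ := exists_gt_mem_timeInterval ht
  obtain ⟨C, hC⟩ := hg.exists_bound hsub
  refine intervalIntegral.continuousWithinAt_of_dominated_interval (bound := fun _ => C)
    ?_ ?_ intervalIntegrable_const ?_
  · filter_upwards [self_mem_nhdsWithin] with s hs using hg.aestronglyMeasurable hs
  · filter_upwards [self_mem_nhdsWithin, mem_nhdsWithin_of_mem_nhds (Iio_mem_nhds hb)] with s hs hsb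
    exact Filter.Eventually.of_forall fun x hx => hC x (uIoc_subset_param hx) s ⟨hs.1, le_of_lt hsb⟩
  · exact Filter.Eventually.of_forall fun x hx =>
      (hg.hasDerivWithinAt_dt (uIoc_subset_param hx) ht).continuousWithinAt

lemma SmoothOn.hasDerivAt_integral {T : EReal} (hT : 0 < T) {g : ℝ → ℝ → ℝ}
    (hg : SmoothOn (timeInterval T) g) {t : ℝ} (ht : t ∈ timeInterval T) (h0 : 0 < t) :
    HasDerivAt (fun t => ∫ x in (-1 : ℝ)..1, g x t)
      (∫ x in (-1 : ℝ)..1, CurveFlow.dt (timeInterval T) g x t) t := by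
  obtain ⟨b, hb, hsub⟩ := exists_gt_mem_timeInterval ht
  have hg' := hg.dt (convex_timeInterval T) (interior_timeInterval_nonempty hT)
  obtain ⟨C, hC⟩ := hg'.exists_bound hsub
  have hnear : Ioo 0 b ∈ nhds t := Ioo_mem_nhds h0 hb
  refine (intervalIntegral.hasDerivAt_integral_of_dominated_loc_of_deriv_le (bound := fun _ => C)
    (F := fun t x => g x t) (F' := fun t x => CurveFlow.dt (timeInterval T) g x t)
    hnear ?_ ?_ (hg'.aestronglyMeasurable ht) ?_ intervalIntegrable_const ?_).2
  · filter_upwards [hnear] with s hs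
    exact hg.aestronglyMeasurable (hsub (Ioo_subset_Icc_self hs))
  · exact ((hg.continuousOn_left ht).mono (by simp [param])).intervalIntegrable
  · exact Filter.Eventually.of_forall fun x hx s hs =>
      hC x (uIoc_subset_param hx) s (Ioo_subset_Icc_self hs)
  · refine Filter.Eventually.of_forall fun x hx s hs => ?_
    have hs' := hsub (Ioo_subset_Icc_self hs)
    exact (hg.hasDerivWithinAt_dt (uIoc_subset_param hx) hs').hasDerivAt
      (timeInterval_mem_nhds hs' hs.1)

-- Plane curves moving in normal direction

local notation "⟪" x ", " y "⟫" => inner ℝ x y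

/-- The anticlockwise rotation by a right angle. -/
noncomputable def rot : Plane →L[ℝ] Plane :=
  LinearMap.toContinuousLinearMap
    { toFun := fun x => !₂[-(x 1), x 0]
      map_add' := fun x y => by
        ext i; fin_cases i
        · simp [add_comm]
        · simp
      map_smul' := fun a x => by ext i; fin_cases i <;> simp }

@[simp] lemma rot_zero_coord (x : Plane) : rot x 0 = -(x 1) := rfl
@[simp] lemma rot_one_coord (x : Plane) : rot x 1 = x 0 := rfl

lemma inner_plane (x y : Plane) : ⟪x, y⟫ = x 0 * y 0 + x 1 * y 1 := by
  simp [PiLp.inner_apply, Fin.sum_univ_two]; ring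

lemma inner_rot_self (x : Plane) : ⟪rot x, x⟫ = 0 := by
  simp only [inner_plane, rot_zero_coord, rot_one_coord]; ring

lemma inner_rot_rot (x y : Plane) : ⟪rot x, rot y⟫ = ⟪x, y⟫ := by
  simp only [inner_plane, rot_zero_coord, rot_one_coord]; ring

lemma rot_rot (x : Plane) : rot (rot x) = -x := by
  ext i; fin_cases i <;> simp

lemma eq_add_rot {τ : Plane} (h : ⟪τ, τ⟫ = 1) (w : Plane) :
    w = ⟪w, τ⟫ • τ + ⟪w, rot τ⟫ • rot τ := by
  simp only [inner_plane] at h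
  ext i; fin_cases i
  · simp [inner_plane]
    linear_combination -(w 0) * h
  · simp [inner_plane]
    linear_combination -(w 1) * h

lemma normal_eq_rot (c : ℝ → Plane) (x : ℝ) : normal c x = rot (tangent c x) := rfl

lemma curvDeriv_succ (c : ℝ → Plane) (n : ℕ) :
    curvDeriv c (n + 1) = arcDeriv c (curvDeriv c n) := by
  rw [curvDeriv, Function.iterate_succ_apply']; rfl

/-- A smooth family of regular curves moving in normal direction. -/
structure NormalMotion (J : Set ℝ) (γ : ℝ → ℝ → Plane) (F : ℝ → ℝ → ℝ) : Prop where
  convex : Convex ℝ J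
  interior : (interior J).Nonempty
  smooth : SmoothOn J γ
  regular : ∀ x ∈ param, ∀ t ∈ J, dx γ x t ≠ 0
  evolution : ∀ x ∈ param, ∀ t ∈ J,
    HasDerivWithinAt (fun r => γ x r) (F x t • normal (fun y => γ y t) x) J t

namespace NormalMotion

variable {J : Set ℝ} {γ : ℝ → ℝ → Plane} {F : ℝ → ℝ → ℝ}

lemma uniqueDiffOn (h : NormalMotion J γ F) : UniqueDiffOn ℝ J :=
  uniqueDiffOn_convex h.convex h.interior

lemma speed_pos (h : NormalMotion J γ F) {x t : ℝ} (hx : x ∈ param) (ht : t ∈ J) :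
    0 < speed (fun y => γ y t) x := norm_pos_iff.2 (h.regular x hx t ht)

lemma smooth_speed (h : NormalMotion J γ F) : SmoothOn J fun x t => speed (fun y => γ y t) x :=
  ContDiffOn.norm ℝ (h.smooth.dx h.convex h.interior) fun p hp => h.regular p.1 hp.1 p.2 hp.2

lemma smooth_arcDeriv (h : NormalMotion J γ F) {V : Type*} [NormedAddCommGroup V]
    [NormedSpace ℝ V] {f : ℝ → ℝ → V} (hf : SmoothOn J f) :
    SmoothOn J fun x t => arcDeriv (fun y => γ y t) (fun y => f y t) x :=
  ContDiffOn.smul (h.smooth_speed.inv fun _ hp => (h.speed_pos hp.1 hp.2).ne')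
    (hf.dx h.convex h.interior)

lemma dx_eq (h : NormalMotion J γ F) {V : Type*} [NormedAddCommGroup V]
    [NormedSpace ℝ V] (f : ℝ → ℝ → V) {x t : ℝ} (hx : x ∈ param) (ht : t ∈ J) :
    dx f x t = speed (fun y => γ y t) x • arcDeriv (fun y => γ y t) (fun y => f y t) x := by
  rw [arcDeriv, smul_smul, mul_inv_cancel₀ (h.speed_pos hx ht).ne', one_smul]
  rfl

lemma smooth_tangent (h : NormalMotion J γ F) :
    SmoothOn J fun x t => tangent (fun y => γ y t) x := h.smooth_arcDeriv h.smooth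

lemma smooth_normal (h : NormalMotion J γ F) :
    SmoothOn J fun x t => normal (fun y => γ y t) x :=
  rot.contDiff.comp_contDiffOn h.smooth_tangent

lemma smooth_curvature (h : NormalMotion J γ F) :
    SmoothOn J fun x t => curvature (fun y => γ y t) x :=
  ContDiffOn.inner ℝ (h.smooth_arcDeriv h.smooth_tangent) h.smooth_normal

lemma smooth_curvDeriv (h : NormalMotion J γ F) (n : ℕ) :
    SmoothOn J fun x t => curvDeriv (fun y => γ y t) n x := by
  induction n with
  | zero => exact h.smooth_curvature
  | succ n ih =>
    simp only [curvDeriv_succ]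
    exact h.smooth_arcDeriv ih

lemma inner_tangent_self (h : NormalMotion J γ F) {x t : ℝ} (hx : x ∈ param) (ht : t ∈ J) :
    ⟪tangent (fun y => γ y t) x, tangent (fun y => γ y t) x⟫ = 1 := by
  rw [real_inner_self_eq_norm_sq]
  have hs := h.speed_pos hx ht
  have : ‖tangent (fun y => γ y t) x‖ = 1 := by
    rw [tangent, arcDeriv, norm_smul, norm_inv, Real.norm_of_nonneg hs.le]
    exact inv_mul_cancel₀ hs.ne'
  rw [this, one_pow]

lemma inner_normal_self (h : NormalMotion J γ F) {x t : ℝ} (hx : x ∈ param) (ht : t ∈ J) :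
    ⟪normal (fun y => γ y t) x, normal (fun y => γ y t) x⟫ = 1 := by
  rw [normal_eq_rot, inner_rot_rot, h.inner_tangent_self hx ht]

lemma inner_normal_tangent (x t : ℝ) :
    ⟪normal (fun y => γ y t) x, tangent (fun y => γ y t) x⟫ = 0 := inner_rot_self _

/-- Frenet formula for the tangent. -/
lemma hasDerivWithinAt_tangent (h : NormalMotion J γ F) {x t : ℝ} (hx : x ∈ param)
    (ht : t ∈ J) : HasDerivWithinAt (fun y => tangent (fun y => γ y t) y)
      ((speed (fun y => γ y t) x * curvature (fun y => γ y t) x) • normal (fun y => γ y t) x)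
      param x := by
  have h1 := h.smooth_tangent.hasDerivWithinAt_dx hx ht
  rw [h.dx_eq _ hx ht] at h1
  have h2 := h1.inner ℝ h1
  have h3 : HasDerivWithinAt (fun y => ⟪tangent (fun y => γ y t) y, tangent (fun y => γ y t) y⟫) 0
      param x := (hasDerivWithinAt_const x param (1 : ℝ)).congr
        (fun y hy => h.inner_tangent_self hy ht) (h.inner_tangent_self hx ht)
  have h4 := (uniqueDiffOn_param x hx).eq_deriv _ h2 h3
  set w := arcDeriv (fun y => γ y t) (fun y => tangent (fun y => γ y t) y) x with hw
  rw [real_inner_comm, ← two_mul, real_inner_smul_left] at h4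
  have h5 : ⟪w, tangent (fun y => γ y t) x⟫ = 0 := by
    have := h.speed_pos hx ht
    simpa [this.ne'] using h4
  have h6 := eq_add_rot (h.inner_tangent_self hx ht) w
  rw [h5, zero_smul, zero_add] at h6
  rw [mul_smul]
  rw [h6] at h1
  exact h1

/-- Frenet formula for the normal. -/
lemma hasDerivWithinAt_normal (h : NormalMotion J γ F) {x t : ℝ} (hx : x ∈ param)
    (ht : t ∈ J) : HasDerivWithinAt (fun y => normal (fun y => γ y t) y)
      (-((speed (fun y => γ y t) x * curvature (fun y => γ y t) x) •
        tangent (fun y => γ y t) x)) param x := by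
  have h1 := rot.hasFDerivAt.comp_hasDerivWithinAt x (h.hasDerivWithinAt_tangent hx ht)
  refine h1.congr_deriv ?_
  rw [map_smul, normal_eq_rot, rot_rot, smul_neg]

lemma hasDerivWithinAt_curvDeriv (h : NormalMotion J γ F) (n : ℕ) {x t : ℝ} (hx : x ∈ param)
    (ht : t ∈ J) : HasDerivWithinAt (fun y => curvDeriv (fun y => γ y t) n y)
      (speed (fun y => γ y t) x * curvDeriv (fun y => γ y t) (n + 1) x) param x := by
  have h1 := (h.smooth_curvDeriv n).hasDerivWithinAt_dx hx ht
  rw [h.dx_eq _ hx ht] at h1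
  rw [curvDeriv_succ]
  exact h1

/-- Space derivative of the velocity. -/
lemma hasDerivWithinAt_velocity (h : NormalMotion J γ F) {F' x t : ℝ} (hx : x ∈ param)
    (ht : t ∈ J) (hF : HasDerivWithinAt (fun y => F y t) F' param x) :
    dt J (dx γ) x t = F' • normal (fun y => γ y t) x
      - (F x t * (speed (fun y => γ y t) x * curvature (fun y => γ y t) x)) •
          tangent (fun y => γ y t) x := by
  rw [h.smooth.dt_dx h.convex h.interior hx ht]
  have h1 := hF.smul (h.hasDerivWithinAt_normal hx ht)
  have h2 : HasDerivWithinAt (fun y => dt J γ y t) _ param x := h1.congr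
    (fun y hy => (h.evolution y hy t ht).derivWithin (h.uniqueDiffOn t ht))
    ((h.evolution x hx t ht).derivWithin (h.uniqueDiffOn t ht))
  rw [dx, h2.derivWithin (uniqueDiffOn_param x hx), smul_neg, smul_smul]
  abel

/-- Evolution of the line element. -/
lemma hasDerivWithinAt_speed_time (h : NormalMotion J γ F) {F' x t : ℝ} (hx : x ∈ param)
    (ht : t ∈ J) (hF : HasDerivWithinAt (fun y => F y t) F' param x) :
    HasDerivWithinAt (fun r => speed (fun y => γ y r) x)
      (-(curvature (fun y => γ y t) x * F x t * speed (fun y => γ y t) x)) J t := by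
  have hs := h.speed_pos hx ht
  have h1 := h.smooth_speed.hasDerivWithinAt_dt hx ht
  have h2 := (h.smooth.dx h.convex h.interior).hasDerivWithinAt_dt hx ht
  -- The time derivative of $|\gamma_x|^2$ is computed in two ways; the positive factor
  -- $2|\gamma_x|$ is cancelled at the end.
  have h3 := h2.inner ℝ h2
  have h4 : HasDerivWithinAt (fun r => speed (fun y => γ y r) x ^ 2) _ J t := h3.congr
    (fun r _ => (real_inner_self_eq_norm_sq _).symm) (real_inner_self_eq_norm_sq _).symm
  have h5 := (h.uniqueDiffOn t ht).eq_deriv _ (h1.pow 2) h4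
  have h6 : dx γ x t = speed (fun y => γ y t) x • tangent (fun y => γ y t) x :=
    h.dx_eq γ hx ht
  rw [h.hasDerivWithinAt_velocity hx ht hF, h6] at h5
  simp only [inner_sub_left, inner_sub_right, real_inner_smul_left, real_inner_smul_right,
    h.inner_tangent_self hx ht, inner_normal_tangent,
    real_inner_comm (normal (fun y => γ y t) x) (tangent (fun y => γ y t) x)] at h5
  refine h1.congr_deriv ?_
  have : 2 * speed (fun y => γ y t) x * dt J (fun x t => speed (fun y => γ y t) x) x t
      = 2 * speed (fun y => γ y t) x *
        (-(curvature (fun y => γ y t) x * F x t * speed (fun y => γ y t) x)) := by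
    norm_num at h5
    rw [h5]; ring
  exact mul_left_cancel₀ (by positivity) this

/-- Evolution of the tangent. -/
lemma hasDerivWithinAt_tangent_time (h : NormalMotion J γ F) {F₁ x t : ℝ} (hx : x ∈ param)
    (ht : t ∈ J)
    (hF : HasDerivWithinAt (fun y => F y t) (speed (fun y => γ y t) x * F₁) param x) :
    HasDerivWithinAt (fun r => tangent (fun y => γ y r) x) (F₁ • normal (fun y => γ y t) x) J t := by
  have hs := h.speed_pos hx ht
  have h1 := h.smooth_tangent.hasDerivWithinAt_dt hx ht
  have h2 := (h.smooth.dx h.convex h.interior).hasDerivWithinAt_dt hx ht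
  have h3 := (h.hasDerivWithinAt_speed_time hx ht hF).smul h1
  have h4 := h2.congr (fun r hr => (h.dx_eq γ hx hr).symm) (h.dx_eq γ hx ht).symm
  have h5 := (h.uniqueDiffOn t ht).eq_deriv _ h3 h4
  rw [h.hasDerivWithinAt_velocity hx ht hF] at h5
  refine h1.congr_deriv (smul_right_injective _ hs.ne' ?_)
  simp only []
  rw [← sub_eq_zero] at h5 ⊢
  rw [← h5]
  module

/-- Evolution of the normal. -/
lemma hasDerivWithinAt_normal_time (h : NormalMotion J γ F) {F₁ x t : ℝ} (hx : x ∈ param)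
    (ht : t ∈ J)
    (hF : HasDerivWithinAt (fun y => F y t) (speed (fun y => γ y t) x * F₁) param x) :
    HasDerivWithinAt (fun r => normal (fun y => γ y r) x)
      (-(F₁ • tangent (fun y => γ y t) x)) J t := by
  have h1 := rot.hasFDerivAt.comp_hasDerivWithinAt t (h.hasDerivWithinAt_tangent_time hx ht hF)
  refine h1.congr_deriv ?_
  rw [map_smul, normal_eq_rot, rot_rot, smul_neg]

/-- Evolution of an arclength derivative. -/
lemma hasDerivWithinAt_arcDeriv_time (h : NormalMotion J γ F) {f g : ℝ → ℝ → ℝ} {F' g' x t : ℝ}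
    (hf : SmoothOn J f) (hx : x ∈ param) (ht : t ∈ J)
    (hF : HasDerivWithinAt (fun y => F y t) F' param x)
    (hfg : ∀ y ∈ param, dt J f y t = g y t)
    (hg : HasDerivWithinAt (fun y => g y t) (speed (fun y => γ y t) x * g') param x) :
    HasDerivWithinAt (fun r => arcDeriv (fun y => γ y r) (fun y => f y r) x)
      (g' + curvature (fun y => γ y t) x * F x t *
        arcDeriv (fun y => γ y t) (fun y => f y t) x) J t := by
  have hs := h.speed_pos hx ht
  have h1 := (h.smooth_arcDeriv hf).hasDerivWithinAt_dt hx ht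
  have h2 := (hf.dx h.convex h.interior).hasDerivWithinAt_dt hx ht
  -- Differentiating $|\gamma_x|f_s=f_x$ in time produces the commutator
  -- $[\partial_t,\partial_s]=kF\,\partial_s$.
  have h3 := (h.hasDerivWithinAt_speed_time hx ht hF).mul h1
  have h4 := h2.congr (fun r hr => (h.dx_eq f hx hr).symm) (h.dx_eq f hx ht).symm
  have h5 := (h.uniqueDiffOn t ht).eq_deriv _ h3 h4
  have h6 : dt J (dx f) x t = speed (fun y => γ y t) x * g' := by
    rw [hf.dt_dx h.convex h.interior hx ht]
    exact (hg.congr hfg (hfg x hx)).derivWithin (uniqueDiffOn_param x hx)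
  rw [h6] at h5
  refine h1.congr_deriv (mul_left_cancel₀ hs.ne' ?_)
  linear_combination h5

/-- Evolution of the curvature. -/
lemma hasDerivWithinAt_curvature_time (h : NormalMotion J γ F) {F₁ : ℝ → ℝ} {F₂ x t : ℝ}
    (hx : x ∈ param) (ht : t ∈ J)
    (hF : ∀ y ∈ param,
      HasDerivWithinAt (fun y => F y t) (speed (fun y => γ y t) y * F₁ y) param y)
    (hF₁ : HasDerivWithinAt F₁ (speed (fun y => γ y t) x * F₂) param x) :
    HasDerivWithinAt (fun r => curvature (fun y => γ y r) x)
      (F₂ + curvature (fun y => γ y t) x ^ 2 * F x t) J t := by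
  have hs := h.speed_pos hx ht
  have h1 := h.smooth_curvature.hasDerivWithinAt_dt hx ht
  -- The Frenet identity $\tau_x=|\gamma_x|k\nu$ is differentiated in time, compared with
  -- $\partial_x(\partial_t\tau)=\partial_x(F_s\nu)$, and paired with $\nu$.
  have h2 := (h.smooth_tangent.dx h.convex h.interior).hasDerivWithinAt_dt hx ht
  have h3 := ((h.hasDerivWithinAt_speed_time hx ht (hF x hx)).mul h1).smul
    (h.hasDerivWithinAt_normal_time hx ht (hF x hx))
  have hfr : ∀ r ∈ J, dx (fun x t => tangent (fun y => γ y t) x) x r =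
      (speed (fun y => γ y r) x * curvature (fun y => γ y r) x) • normal (fun y => γ y r) x :=
    fun r hr => (h.hasDerivWithinAt_tangent hx hr).derivWithin (uniqueDiffOn_param x hx)
  have h4 := h2.congr (fun r hr => (hfr r hr).symm) (hfr t ht).symm
  have h5 := (h.uniqueDiffOn t ht).eq_deriv _ h3 h4
  have h6 := ((hF₁.smul (h.hasDerivWithinAt_normal hx ht)).congr
      (fun y hy => (h.hasDerivWithinAt_tangent_time hy ht (hF y hy)).derivWithin
        (h.uniqueDiffOn t ht))
      ((h.hasDerivWithinAt_tangent_time hx ht (hF x hx)).derivWithin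
        (h.uniqueDiffOn t ht))).derivWithin (uniqueDiffOn_param x hx)
  rw [h.smooth_tangent.dt_dx h.convex h.interior hx ht] at h5
  replace h5 := h5.trans h6
  have h7 := congrArg (fun w => ⟪w, normal (fun y => γ y t) x⟫) h5
  simp only [inner_add_left, inner_neg_left, real_inner_smul_left, smul_neg,
    h.inner_normal_self hx ht,
    real_inner_comm (normal (fun y => γ y t) x) (tangent (fun y => γ y t) x),
    inner_normal_tangent] at h7
  refine h1.congr_deriv (mul_left_cancel₀ hs.ne' ?_)
  linear_combination h7

end NormalMotion

/-! ### Evolution along the gradient flow -/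

lemma flowSpeed_eq_polyEval (m : ℕ) (c : ℝ → Plane) (x : ℝ) :
    flowSpeed m c x = polyEval (curvDeriv c) (speedPoly m) x := by
  have h0 : curvature c = curvDeriv c 0 := rfl
  simp [flowSpeed, polyEval, speedPoly, speedCubic, h0]
  ring

/-- A motion by the normal speed of the gradient flow. -/
abbrev FlowMotion (m : ℕ) (J : Set ℝ) (γ : ℝ → ℝ → Plane) : Prop :=
  NormalMotion J γ fun x t => polyEval (curvDeriv fun y => γ y t) (speedPoly m) x

lemma IsGradientFlow.flowMotion {m : ℕ} {e : Plane} {a d : ℝ} {T : EReal} {γ₀ : ℝ → Plane}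
    {γ : ℝ → ℝ → Plane} (h : IsGradientFlow m e a d T γ₀ γ) :
    FlowMotion m (timeInterval T) γ where
  convex := convex_timeInterval T
  interior := interior_timeInterval_nonempty h.time_pos
  smooth := h.smooth
  regular := fun x hx t ht => (h.neumann t ht).regular x hx
  evolution := fun x hx t ht => by
    rw [← flowSpeed_eq_polyEval]; exact h.evolution x hx t ht

namespace NormalMotion

lemma hasDerivWithinAt_polyEval_curvDeriv {J : Set ℝ} {γ : ℝ → ℝ → Plane} {F : ℝ → ℝ → ℝ}
    (h : NormalMotion J γ F) (p : MvPolynomial ℕ ℝ) {x t : ℝ} (hx : x ∈ param) (ht : t ∈ J) :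
    HasDerivWithinAt (polyEval (curvDeriv fun y => γ y t) p)
      (speed (fun y => γ y t) x * polyEval (curvDeriv fun y => γ y t) (formalD p) x) param x :=
  hasDerivWithinAt_polyEval (fun i => h.hasDerivWithinAt_curvDeriv i hx ht) p

variable {m : ℕ} {J : Set ℝ} {γ : ℝ → ℝ → Plane}

/-- Evolution of the arclength derivatives of the curvature along the flow. -/
lemma hasDerivWithinAt_curvDeriv_time (h : FlowMotion m J γ) (i : ℕ) {x t : ℝ}
    (hx : x ∈ param) (ht : t ∈ J) :
    HasDerivWithinAt (fun r => curvDeriv (fun y => γ y r) i x)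
      (polyEval (curvDeriv fun y => γ y t) (timePoly m i) x) J t := by
  induction i generalizing x t with
  | zero =>
    have h1 := h.hasDerivWithinAt_curvature_time hx ht
      (fun y hy => h.hasDerivWithinAt_polyEval_curvDeriv (speedPoly m) hy ht)
      (h.hasDerivWithinAt_polyEval_curvDeriv (formalD (speedPoly m)) hx ht)
    refine h1.congr_deriv ?_
    simp [timePoly, polyEval]
    exact Or.inl rfl
  | succ i ih =>
    have h1 := h.hasDerivWithinAt_arcDeriv_time
      (g := fun x t => polyEval (curvDeriv fun y => γ y t) (timePoly m i) x)
      (h.smooth_curvDeriv i) hx ht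
      (h.hasDerivWithinAt_polyEval_curvDeriv (speedPoly m) hx ht)
      (fun y hy => (ih hy ht).derivWithin (h.uniqueDiffOn t ht))
      (h.hasDerivWithinAt_polyEval_curvDeriv (timePoly m i) hx ht)
    simp only [curvDeriv_succ]
    refine h1.congr_deriv ?_
    simp [timePoly, polyEval, curvDeriv_succ]
    exact Or.inl (Or.inl rfl)

/-- At a point where the normal is fixed and the odd derivatives of the curvature vanish up to
order `2 m + 1`, all of them vanish. -/
lemma curvDeriv_eq_zero_of_odd (h : FlowMotion m J γ) {e : Plane} (he : ‖e‖ = 1) {x : ℝ}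
    (hx : x ∈ param) (horth : ∀ t ∈ J, inner ℝ (normal (fun y => γ y t) x) e = 0)
    (hodd : ∀ t ∈ J, ∀ j ≤ m, curvDeriv (fun y => γ y t) (2 * j + 1) x = 0) :
    ∀ i, Odd i → ∀ t ∈ J, curvDeriv (fun y => γ y t) i x = 0 := by
  intro i
  induction i using Nat.strong_induction_on with
  | _ i ih =>
    intro hi t ht
    rcases lt_trichotomy i (2 * m + 3) with hlt | rfl | hgt
    · obtain ⟨j, rfl⟩ := hi
      exact hodd t ht j (by omega)
    -- Orthogonality $\langle\nu,e\rangle=0$ persists, so its time derivative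
    -- $-F_s\langle\tau,e\rangle$ vanishes, and $\langle\tau,e\rangle\ne0$ because $\tau,\nu$ span
    -- the plane. In $F_s=0$ the cubic part has odd order $2m+1$ and drops out, leaving the top
    -- derivative.
    · have h1 := h.hasDerivWithinAt_normal_time hx ht
        (h.hasDerivWithinAt_polyEval_curvDeriv (speedPoly m) hx ht)
      have h2 := h1.inner ℝ (hasDerivWithinAt_const t J e)
      have h3 := (hasDerivWithinAt_const t J (0 : ℝ)).congr horth (horth t ht)
      have h4 := (h.uniqueDiffOn t ht).eq_deriv _ h2 h3
      have hτ : inner ℝ (tangent (fun y => γ y t) x) e ≠ 0 := by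
        intro h0
        have h5 := eq_add_rot (h.inner_tangent_self hx ht) e
        rw [real_inner_comm, h0, ← normal_eq_rot, real_inner_comm, horth t ht] at h5
        simp only [zero_smul, add_zero] at h5
        rw [h5, norm_zero] at he
        exact zero_ne_one he
      rw [inner_zero_right, zero_add, inner_neg_left, real_inner_smul_left, neg_eq_zero,
        mul_eq_zero, or_iff_left hτ] at h4
      have h5 := aeval_eq_zero_of_odd (formalD_mem_diffPoly (speedCubic_mem m))
        (by rw [Nat.odd_iff]; omega) (κ := fun i => curvDeriv (fun y => γ y t) i x)
        fun j hj hjo => ih j (by omega) hjo t ht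
      rw [polyEval, speedPoly, map_add, map_add, h5, Derivation.map_smul, formalD_X, map_smul,
        aeval_X, add_zero, smul_eq_mul, mul_eq_zero] at h4
      exact h4.resolve_left (pow_ne_zero _ (by norm_num))
    -- Here $\kappa_j=0$ for all times with $j$ odd, so $\partial_t\kappa_j=0$; its nonlinear parts
    -- have odd order below $i$ and vanish by induction, leaving $\kappa_{j+2m+4}=0$.
    · obtain ⟨j, rfl⟩ : ∃ j, i = j + 2 * m + 4 := ⟨i - (2 * m + 4), by omega⟩
      have hj : Odd j := by rw [Nat.odd_iff] at hi ⊢; omega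
      have h1 := h.hasDerivWithinAt_curvDeriv_time j hx ht
      have h3 := (hasDerivWithinAt_const t J (0 : ℝ)).congr
        (fun r hr => ih j (by omega) hj r hr) (ih j (by omega) hj t ht)
      have h4 := (h.uniqueDiffOn t ht).eq_deriv _ h1 h3
      obtain ⟨p, hp, q, hq, hpq⟩ := timePoly_eq m j
      rw [Nat.odd_iff] at hj
      have h5 := aeval_eq_zero_of_odd hp
        (by rw [Nat.odd_iff]; omega) (κ := fun i => curvDeriv (fun y => γ y t) i x)
        fun j hj hjo => ih j (by omega) hjo t ht
      have h6 := aeval_eq_zero_of_odd hq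
        (by rw [Nat.odd_iff]; omega) (κ := fun i => curvDeriv (fun y => γ y t) i x)
        fun j hj hjo => ih j (by omega) hjo t ht
      rw [polyEval, hpq, map_add, map_add, h5, h6, map_smul,
        aeval_X, add_zero, add_zero, smul_eq_mul, mul_eq_zero] at h4
      exact h4.resolve_left (pow_ne_zero _ (by norm_num))

variable {T : EReal}

lemma continuousOn_wInt {F : ℝ → ℝ → ℝ} (h : NormalMotion (timeInterval T) γ F) {f : ℝ → ℝ → ℝ}
    (hf : SmoothOn (timeInterval T) f) :
    ContinuousOn (fun t => wInt (speed fun y => γ y t) fun x => f x t) (timeInterval T) :=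
  SmoothOn.continuousOn_integral (g := fun x t => f x t * speed (fun y => γ y t) x)
    (ContDiffOn.mul hf h.smooth_speed)

/-- The extra term $-kFq$ comes from the evolution of the line element. -/
lemma hasDerivAt_wInt (h : FlowMotion m (timeInterval T) γ) (hT : 0 < T) {f : ℝ → ℝ → ℝ}
    (hf : SmoothOn (timeInterval T) f) {t : ℝ} (ht : t ∈ timeInterval T) (h0 : 0 < t)
    {p q : MvPolynomial ℕ ℝ}
    (hfq : ∀ x ∈ param, f x t = polyEval (curvDeriv fun y => γ y t) q x)
    (hfp : ∀ x ∈ param, HasDerivWithinAt (fun r => f x r)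
      (polyEval (curvDeriv fun y => γ y t) p x) (timeInterval T) t) :
    HasDerivAt (fun t => wInt (speed fun y => γ y t) fun x => f x t)
      (wInt (speed fun y => γ y t)
        (polyEval (curvDeriv fun y => γ y t) (p - X 0 * speedPoly m * q))) t := by
  have h1 := SmoothOn.hasDerivAt_integral (g := fun x t => f x t * speed (fun y => γ y t) x) hT
    (ContDiffOn.mul hf h.smooth_speed) ht h0
  refine h1.congr_deriv ?_
  refine intervalIntegral.integral_congr fun x hx => ?_
  rw [uIcc_of_le (by norm_num)] at hx
  have h2 := (hfp x hx).mul (h.hasDerivWithinAt_speed_time hx ht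
    (h.hasDerivWithinAt_polyEval_curvDeriv (speedPoly m) hx ht))
  have h3 := h2.derivWithin (h.uniqueDiffOn t ht)
  refine h3.trans ?_
  rw [hfq x hx]
  have hk : curvature (fun y => γ y t) x = curvDeriv (fun y => γ y t) 0 x := rfl
  simp [polyEval, hk]
  ring

end NormalMotion

/-- A function on `[0, T)` with vanishing derivative for positive times is constant. -/
lemma eq_initial_of_hasDerivAt_zero {T : EReal} {f : ℝ → ℝ}
    (hc : ContinuousOn f (timeInterval T))
    (hd : ∀ t ∈ timeInterval T, 0 < t → HasDerivAt f 0 t) {t : ℝ} (ht : t ∈ timeInterval T) :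
    f t = f 0 := by
  have hsub : Icc 0 t ⊆ timeInterval T := by
    obtain ⟨b, hb, hsub⟩ := exists_gt_mem_timeInterval ht
    exact (Icc_subset_Icc_right hb.le).trans hsub
  have hd' : ∀ s ∈ interior (Icc 0 t), HasDerivAt f 0 s := by
    rw [interior_Icc]
    exact fun s hs => hd s (hsub (Ioo_subset_Icc_self hs)) hs.1
  have h1 := antitoneOn_of_deriv_nonpos (convex_Icc 0 t) (hc.mono hsub)
    (fun s hs => (hd' s hs).differentiableAt.differentiableWithinAt)
    fun s hs => (hd' s hs).deriv.le
  have h2 := monotoneOn_of_deriv_nonneg (convex_Icc 0 t) (hc.mono hsub)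
    (fun s hs => (hd' s hs).differentiableAt.differentiableWithinAt)
    fun s hs => (hd' s hs).deriv.ge
  have m0 : (0 : ℝ) ∈ Icc 0 t := ⟨le_rfl, ht.1⟩
  have mt : t ∈ Icc 0 t := ⟨ht.1, le_rfl⟩
  exact le_antisymm (h1 m0 mt ht.1) (h2 m0 mt ht.1)

/-- Speed and curvature depend only on the values of the curve on the parameter interval. -/
lemma speed_curvDeriv_congr {c c' : ℝ → Plane} (h : ∀ x ∈ param, c x = c' x) :
    (∀ x ∈ param, speed c x = speed c' x) ∧
      ∀ i, ∀ x ∈ param, curvDeriv c i x = curvDeriv c' i x := by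
  have hs : ∀ x ∈ param, speed c x = speed c' x := fun x hx => by
    rw [speed, speed, derivWithin_congr h (h x hx)]
  have ha : ∀ {V : Type} [NormedAddCommGroup V] [NormedSpace ℝ V] {f g : ℝ → V},
      (∀ x ∈ param, f x = g x) → ∀ x ∈ param, arcDeriv c f x = arcDeriv c' g x := by
    intro V _ _ f g hfg x hx
    rw [arcDeriv, arcDeriv, hs x hx, derivWithin_congr hfg (hfg x hx)]
  have ht : ∀ x ∈ param, tangent c x = tangent c' x := ha h
  refine ⟨hs, fun i => ?_⟩
  induction i with
  | zero =>
    intro x hx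
    change inner ℝ _ _ = inner ℝ _ _
    rw [ha ht x hx, normal_eq_rot, normal_eq_rot, ht x hx]
  | succ i ih =>
    rw [curvDeriv_succ, curvDeriv_succ]
    exact ha ih

lemma wInt_congr {v v' f f' : ℝ → ℝ} (hv : ∀ x ∈ param, v x = v' x)
    (hf : ∀ x ∈ param, f x = f' x) : wInt v f = wInt v' f' := by
  refine intervalIntegral.integral_congr fun x hx => ?_
  rw [uIcc_of_le (by norm_num)] at hx
  simp only [hv x hx, hf x hx]

namespace IsGradientFlow

variable {m : ℕ} {e : Plane} {a d : ℝ} {T : EReal} {γ₀ : ℝ → Plane} {γ : ℝ → ℝ → Plane}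

lemma zero_mem (h : IsGradientFlow m e a d T γ₀ γ) : (0 : ℝ) ∈ timeInterval T :=
  ⟨le_rfl, by simpa using h.time_pos⟩

lemma curvDeriv_left (h : IsGradientFlow m e a d T γ₀ γ) (he : ‖e‖ = 1) :
    ∀ i, Odd i → ∀ t ∈ timeInterval T, curvDeriv (fun y => γ y t) i (-1) = 0 :=
  h.flowMotion.curvDeriv_eq_zero_of_odd he (by simp)
    (fun t ht => (h.neumann t ht).left_orthogonal) fun t ht => (h.neumann t ht).left_odd

lemma curvDeriv_right (h : IsGradientFlow m e a d T γ₀ γ) (he : ‖e‖ = 1) :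
    ∀ i, Odd i → ∀ t ∈ timeInterval T, curvDeriv (fun y => γ y t) i 1 = 0 :=
  h.flowMotion.curvDeriv_eq_zero_of_odd he (by simp)
    (fun t ht => (h.neumann t ht).right_orthogonal) fun t ht => (h.neumann t ht).right_odd

/-- The total curvature is preserved. -/
lemma wInt_curvature (h : IsGradientFlow m e a d T γ₀ γ) (he : ‖e‖ = 1) {t : ℝ}
    (ht : t ∈ timeInterval T) :
    wInt (speed fun y => γ y t) (curvDeriv (fun y => γ y t) 0)
      = wInt (speed fun y => γ y 0) (curvDeriv (fun y => γ y 0) 0) := by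
  have hm := h.flowMotion
  refine eq_initial_of_hasDerivAt_zero
    (f := fun t => wInt (speed fun y => γ y t) (curvDeriv (fun y => γ y t) 0))
    (hm.continuousOn_wInt (hm.smooth_curvDeriv 0)) (fun s hs h0 => ?_) ht
  have h1 := hm.hasDerivAt_wInt h.time_pos (hm.smooth_curvDeriv 0) hs h0 (q := X 0)
    (fun x _ => by simp [polyEval]) fun x hx => hm.hasDerivWithinAt_curvDeriv_time 0 hx hs
  refine h1.congr_deriv ?_
  -- The term $k^2F$ cancels against the change of the line element. What remains is $F_{ss}$, whose
  -- integral is the difference of the end values of $F_s$, and these vanish by parity.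
  have h2 : timePoly m 0 - X 0 * speedPoly m * X 0 = formalD (formalD (speedPoly m)) := by
    rw [timePoly]; ring
  rw [h2]
  have hF : ∀ x ∈ param, (∀ i, Odd i → curvDeriv (fun y => γ y s) i x = 0) →
      polyEval (curvDeriv fun y => γ y s) (formalD (speedPoly m)) x = 0 := by
    intro x _ hodd
    have h5 := aeval_eq_zero_of_odd (formalD_mem_diffPoly (speedCubic_mem m))
        (by rw [Nat.odd_iff]; omega) (κ := fun i => curvDeriv (fun y => γ y s) i x)
        fun j _ hjo => hodd j hjo
    rw [polyEval, speedPoly, map_add, map_add, h5, Derivation.map_smul, formalD_X, map_smul,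
      aeval_X, hodd _ (by rw [Nat.odd_iff]; omega), smul_zero, zero_add]
  set p := formalD (speedPoly m)
  have hder : ∀ x ∈ param, HasDerivWithinAt (polyEval (curvDeriv fun y => γ y s) p)
      (speed (fun y => γ y s) x * polyEval (curvDeriv fun y => γ y s) (formalD p) x) param x :=
    fun x hx => hm.hasDerivWithinAt_polyEval_curvDeriv p hx hs
  have hder' : ∀ x ∈ param, HasDerivWithinAt (polyEval (curvDeriv fun y => γ y s) (formalD p))
      _ param x :=
    fun x hx => hm.hasDerivWithinAt_polyEval_curvDeriv (formalD p) hx hs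
  rw [wInt, intervalIntegral.integral_eq_sub_of_hasDerivAt_of_le
    (f := polyEval (curvDeriv fun y => γ y s) p) (by norm_num)
    (fun x hx => (hder x hx).continuousWithinAt), hF 1 (by simp)
      fun i hi => h.curvDeriv_right he i hi s hs,
    hF (-1) (by simp) fun i hi => h.curvDeriv_left he i hi s hs, sub_zero]
  · intro x hx
    rw [mul_comm]
    exact (hder x (Ioo_subset_Icc_self hx)).hasDerivAt (Icc_mem_nhds hx.1 hx.2)
  · refine ContinuousOn.intervalIntegrable ?_
    rw [uIcc_of_le (by norm_num)]
    exact ContinuousOn.mul (fun x hx => (hder' x hx).continuousWithinAt)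
      (hm.smooth_speed.continuousOn_left hs)

/-- Along the flow, the arclength derivatives of the curvature form an `ArcSystem`. -/
lemma arcSystem (h : IsGradientFlow m e a d T γ₀ γ) (he : ‖e‖ = 1)
    (hω : windingNumber γ₀ = 0) {t : ℝ} (ht : t ∈ timeInterval T) :
    ArcSystem (speed fun y => γ y t) (curvDeriv fun y => γ y t) where
  cont := h.flowMotion.smooth_speed.continuousOn_left ht
  pos := fun x hx => h.flowMotion.speed_pos hx ht
  deriv := fun i x hx => h.flowMotion.hasDerivWithinAt_curvDeriv i hx ht
  left := fun i hi => h.curvDeriv_left he i hi t ht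
  right := fun i hi => h.curvDeriv_right he i hi t ht
  mean := by
    have hcg := speed_curvDeriv_congr h.initial
    rw [h.wInt_curvature he ht, wInt_congr hcg.1 (hcg.2 0)]
    rw [windingNumber, mul_eq_zero] at hω
    exact hω.resolve_left (by positivity)

lemma hasDerivAt_sqInt (h : IsGradientFlow m e a d T γ₀ γ) (l : ℕ) {t : ℝ}
    (ht : t ∈ timeInterval T) (h0 : 0 < t) :
    HasDerivAt (fun t => sqInt (speed fun y => γ y t) (curvDeriv fun y => γ y t) l)
      (wInt (speed fun y => γ y t) (polyEval (curvDeriv fun y => γ y t) (energyRate m l))) t := by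
  have hm := h.flowMotion
  refine hm.hasDerivAt_wInt h.time_pos (f := fun x t => curvDeriv (fun y => γ y t) l x ^ 2)
    ((hm.smooth_curvDeriv l).pow 2) ht h0 (p := (2 : ℝ) • (X l * timePoly m l)) (q := X l * X l)
    (fun x _ => by simp [polyEval, pow_two]) fun x hx => ?_
  refine ((hm.hasDerivWithinAt_curvDeriv_time l hx ht).pow 2).congr_deriv ?_
  simp [polyEval]
  ring

lemma hasDerivAt_length (h : IsGradientFlow m e a d T γ₀ γ) {t : ℝ}
    (ht : t ∈ timeInterval T) (h0 : 0 < t) :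
    HasDerivAt (fun t => wInt (speed fun y => γ y t) fun _ => 1)
      (wInt (speed fun y => γ y t) (polyEval (curvDeriv fun y => γ y t) (lengthRate m))) t := by
  have hm := h.flowMotion
  have := hm.hasDerivAt_wInt h.time_pos (f := fun _ _ => 1) contDiffOn_const ht h0 (p := 0)
    (q := 1) (fun x _ => by simp [polyEval]) fun x hx => by
      simpa [polyEval] using hasDerivWithinAt_const t (timeInterval T) (1 : ℝ)
  rwa [zero_sub, mul_one] at this

lemma continuousOn_sqInt (h : IsGradientFlow m e a d T γ₀ γ) (l : ℕ) :
    ContinuousOn (fun t => sqInt (speed fun y => γ y t) (curvDeriv fun y => γ y t) l)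
      (timeInterval T) :=
  h.flowMotion.continuousOn_wInt (f := fun x t => curvDeriv (fun y => γ y t) l x ^ 2)
    ((h.flowMotion.smooth_curvDeriv l).pow 2)

lemma continuousOn_length (h : IsGradientFlow m e a d T γ₀ γ) :
    ContinuousOn (fun t => wInt (speed fun y => γ y t) fun _ => 1) (timeInterval T) :=
  h.flowMotion.continuousOn_wInt (f := fun _ _ => 1) contDiffOn_const

end IsGradientFlow

/-! ### Comparison principles in time -/

/-- A function which decreases strictly whenever it attains the level `B` stays below it. -/
lemma le_of_barrier {T : EReal} {f f' : ℝ → ℝ} {B : ℝ} (hT : 0 < T)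
    (hc : ContinuousOn f (timeInterval T))
    (hd : ∀ t ∈ timeInterval T, 0 < t → HasDerivAt f (f' t) t) (h0 : f 0 < B)
    (hB : ∀ t ∈ timeInterval T, 0 < t → f t = B → f' t < 0) :
    ∀ t ∈ timeInterval T, f t ≤ B := by
  intro t ht
  rcases ht.1.eq_or_lt with rfl | htpos
  · exact h0.le
  have hsub : Icc 0 t ⊆ timeInterval T := by
    obtain ⟨b, hb, hsub⟩ := exists_gt_mem_timeInterval ht
    exact (Icc_subset_Icc_right hb.le).trans hsub
  -- The derivative is available only for positive times, so the comparison starts at some $s>0$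
  -- still below the level.
  obtain ⟨s, hs0, hst, hsB⟩ : ∃ s, 0 < s ∧ s < t ∧ f s < B := by
    have h1 : ContinuousWithinAt f (Ioo 0 t) 0 :=
      (hc 0 ⟨le_rfl, by simpa using hT⟩).mono (Ioo_subset_Icc_self.trans hsub)
    have h2 : ∀ᶠ s in nhdsWithin 0 (Ioo 0 t), f s < B := h1.eventually (gt_mem_nhds h0)
    have : (nhdsWithin (0 : ℝ) (Ioo 0 t)).NeBot := by
      rw [nhdsWithin_Ioo_eq_nhdsGT htpos]; infer_instance
    obtain ⟨s, hsf, hs⟩ := (h2.and self_mem_nhdsWithin).exists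
    exact ⟨s, hs.1, hs.2, hsf⟩
  have hsub' : Icc s t ⊆ timeInterval T := (Icc_subset_Icc_left hs0.le).trans hsub
  refine image_le_of_deriv_right_lt_deriv_boundary' (B := fun _ => B) (B' := fun _ => 0)
    (hc.mono hsub')
    (fun r hr => (hd r (hsub' (Ico_subset_Icc_self hr)) (hs0.trans_le hr.1)).hasDerivWithinAt)
    hsB.le continuousOn_const (fun r _ => hasDerivWithinAt_const _ _ _)
    (fun r hr heq => hB r (hsub' (Ico_subset_Icc_self hr)) (hs0.trans_le hr.1) heq)
    ⟨hst.le, le_rfl⟩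

lemma le_initial_of_hasDerivAt_nonpos {T : EReal} {f f' : ℝ → ℝ}
    (hc : ContinuousOn f (timeInterval T))
    (hd : ∀ t ∈ timeInterval T, 0 < t → HasDerivAt f (f' t) t)
    (hn : ∀ t ∈ timeInterval T, 0 < t → f' t ≤ 0) {t : ℝ} (ht : t ∈ timeInterval T) :
    f t ≤ f 0 := by
  have hsub : Icc 0 t ⊆ timeInterval T := by
    obtain ⟨b, hb, hsub⟩ := exists_gt_mem_timeInterval ht
    exact (Icc_subset_Icc_right hb.le).trans hsub
  have hin : ∀ s ∈ interior (Icc 0 t), s ∈ timeInterval T ∧ 0 < s := by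
    rw [interior_Icc]
    exact fun s hs => ⟨hsub (Ioo_subset_Icc_self hs), hs.1⟩
  have h1 := antitoneOn_of_deriv_nonpos (convex_Icc 0 t) (hc.mono hsub)
    (fun s hs => (hd s (hin s hs).1 (hin s hs).2).differentiableAt.differentiableWithinAt)
    fun s hs => by
      rw [(hd s (hin s hs).1 (hin s hs).2).deriv]; exact hn s (hin s hs).1 (hin s hs).2
  exact h1 ⟨le_rfl, ht.1⟩ ⟨ht.1, le_rfl⟩ ht.1

/-- Exponential decay from a linear differential inequality with resonant right-hand side. -/
lemma le_mul_exp_of_deriv_le {T : EReal} {f f' : ℝ → ℝ} {A β : ℝ}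
    (hc : ContinuousOn f (timeInterval T))
    (hd : ∀ t ∈ timeInterval T, 0 < t → HasDerivAt f (f' t) t)
    (hn : ∀ t ∈ timeInterval T, 0 < t → f' t ≤ -β * f t + A * Real.exp (-β * t))
    {t : ℝ} (ht : t ∈ timeInterval T) : f t ≤ (f 0 + A * t) * Real.exp (-β * t) := by
  -- Integrating factor: $e^{\beta t}f(t)-At$ is nonincreasing.
  have h1 := le_initial_of_hasDerivAt_nonpos (T := T)
    (f := fun t => Real.exp (β * t) * f t - A * t)
    (f' := fun t => (Real.exp (β * t) * β * f t + Real.exp (β * t) * f' t) - A)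
    (by fun_prop) (fun s hs h0 => by
      have e1 : HasDerivAt (fun t => Real.exp (β * t)) (Real.exp (β * s) * β) s := by
        simpa using ((hasDerivAt_id s).const_mul β).exp
      have e2 : HasDerivAt (fun t => A * t) A s := by
        simpa using (hasDerivAt_id s).const_mul A
      exact (e1.mul (hd s hs h0)).sub e2)
    (fun s hs h0 => by
      have h2 := mul_le_mul_of_nonneg_left (hn s hs h0) (Real.exp_pos (β * s)).le
      have h3 : Real.exp (β * s) * Real.exp (-β * s) = 1 := by
        rw [← Real.exp_add]; simp
      have h4 : Real.exp (β * s) * (-β * f s + A * Real.exp (-β * s))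
          = -(Real.exp (β * s) * β * f s) + A := by
        linear_combination A * h3
      linarith) ht
  simp only [mul_zero, Real.exp_zero, one_mul, sub_zero] at h1
  have h3 : Real.exp (β * t) * Real.exp (-β * t) = 1 := by
    rw [← Real.exp_add]; simp
  have h5 := mul_le_mul_of_nonneg_right (sub_le_iff_le_add.1 h1) (Real.exp_pos (-β * t)).le
  calc f t = Real.exp (β * t) * f t * Real.exp (-β * t) := by
        linear_combination -(f t) * h3
    _ ≤ _ := h5

/-- Half of the rate pays for the linear factor produced by resonance. -/
lemma mul_exp_neg_le {β t : ℝ} (hβ : 0 < β) :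
    t * Real.exp (-β * t) ≤ 2 / β * Real.exp (-(β / 2) * t) := by
  have h1 : β / 2 * t ≤ Real.exp (β / 2 * t) := by
    linarith [Real.add_one_le_exp (β / 2 * t)]
  have h2 : t ≤ 2 / β * Real.exp (β / 2 * t) := by
    rw [div_mul_eq_mul_div, le_div_iff₀ hβ]; linarith
  calc t * Real.exp (-β * t) ≤ 2 / β * Real.exp (β / 2 * t) * Real.exp (-β * t) := by gcongr
    _ = 2 / β * Real.exp (-(β / 2) * t) := by
      rw [mul_assoc, ← Real.exp_add]; congr 2; ring

/-! ### Smallness, its preservation, and decay -/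

lemma ArcSystem.mul_sqInt_zero_le {v : ℝ → ℝ} {κ : ℕ → ℝ → ℝ} (h : ArcSystem v κ) (m : ℕ) :
    (wInt v fun _ => 1) * sqInt v κ 0 ≤ (wInt v fun _ => 1) ^ (2 * m + 1) * sqInt v κ m := by
  have h1 := h.sqInt_le_pow 0 m
  rw [zero_add] at h1
  calc _ ≤ (wInt v fun _ => 1) * ((wInt v fun _ => 1) ^ (2 * m) * sqInt v κ m) :=
        mul_le_mul_of_nonneg_left h1 h.length_pos.le
    _ = _ := by ring

/-- If the scale-invariant energy is small, the length decreases along the flow and the energy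
decreases at a definite rate. -/
lemma exists_small_energy_rates (m : ℕ) :
    ∃ c : ℝ, 0 < c ∧ c ≤ 1 ∧ ∀ (v : ℝ → ℝ) (κ : ℕ → ℝ → ℝ), ArcSystem v κ →
      (wInt v fun _ => 1) ^ (2 * m + 1) * sqInt v κ m ≤ c →
      wInt v (polyEval κ (lengthRate m)) ≤ 0 ∧
      wInt v (polyEval κ (energyRate m m)) ≤ -sqInt v κ (m + (m + 2)) := by
  obtain ⟨C₁, hC₁, h₁⟩ := exists_energyRate_bound m m
  obtain ⟨C₂, hC₂, h₂⟩ := exists_lengthRate_bound m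
  have hpos : 0 < C₁ + C₂ + 1 := by positivity
  -- With this threshold $Y=LE_0$ satisfies $Y\le1$, $C_2Y\le1$ and $C_1(y+y^2)\le2C_1Y\le1$, so at
  -- least half of the dissipation $-2E_{2m+2}$ survives.
  refine ⟨1 / (2 * (C₁ + C₂ + 1)), by positivity, ?_, fun v κ hs hsmall => ?_⟩
  · rw [div_le_one (by positivity)]; linarith
  have hG := (hs.mul_sqInt_zero_le m).trans hsmall
  rw [le_div_iff₀ (by positivity)] at hG
  obtain ⟨y, hy0, hyL, -, hy⟩ := h₁ v κ hs
  have hl := h₂ v κ hs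
  have e1 := hs.sqInt_nonneg (m + 1)
  have e2 := hs.sqInt_nonneg (m + m + 2)
  set Y := (wInt v fun _ => 1) * sqInt v κ 0
  have hY : 0 ≤ Y := hy0.trans hyL
  have hY1 : Y ≤ 1 := by nlinarith
  constructor
  · have : C₂ * Y ≤ 1 := by nlinarith
    nlinarith
  · have hyy : C₁ * (y + y ^ 2) ≤ 1 := by
      have h3 : y + y ^ 2 ≤ 2 * Y := by nlinarith
      have h4 : C₁ * (y + y ^ 2) ≤ C₁ * (2 * Y) := mul_le_mul_of_nonneg_left h3 hC₁
      nlinarith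
    rw [← add_assoc]
    nlinarith

/-- The energy rate of order `l`, once the scale-invariant energy is small. -/
lemma exists_energyRate_le (m l : ℕ) :
    ∃ D : ℝ, 0 ≤ D ∧ ∀ (v : ℝ → ℝ) (κ : ℕ → ℝ → ℝ), ArcSystem v κ →
      (wInt v fun _ => 1) ^ (2 * m + 1) * sqInt v κ m ≤ 1 →
      wInt v (polyEval κ (energyRate m l)) ≤
        -sqInt v κ (l + (m + 2)) + D * sqInt v κ 0 ^ (2 * (l + m + 2) + 1) := by
  obtain ⟨C, hC, h⟩ := exists_energyRate_bound m l
  refine ⟨(2 * C) ^ (2 * (l + m + 2) + 1), by positivity, fun v κ hs hsmall => ?_⟩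
  obtain ⟨y, hy0, hyL, hyE, hy⟩ := h v κ hs
  have hy1 : y ≤ 1 := hyL.trans ((hs.mul_sqInt_zero_le m).trans hsmall)
  have e2 := hs.sqInt_nonneg (l + m + 2)
  have e0 := hs.sqInt_nonneg 0
  rw [← add_assoc]
  set n := l + m + 2
  have hyy : C * (y + y ^ 2) * sqInt v κ n ≤ 2 * C * y * sqInt v κ n := by
    refine mul_le_mul_of_nonneg_right ?_ e2
    have : y ^ 2 ≤ y := by nlinarith
    nlinarith
  have hD : 0 ≤ (2 * C) ^ (2 * n + 1) * sqInt v κ 0 ^ (2 * n + 1) := by positivity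
  -- If $2Cy\le1$ the error is absorbed. Otherwise $1\le(2Cy)^{2n}$, and $y^{2n}E_n=E_0^{2n+1}$
  -- bounds $E_n$ by a power of $E_0$, with no further smallness depending on $l$.
  rcases le_or_gt (2 * C * y) 1 with hle | hgt
  · have : 2 * C * y * sqInt v κ n ≤ 1 * sqInt v κ n := mul_le_mul_of_nonneg_right hle e2
    linarith
  · have h1 : 1 ≤ (2 * C * y) ^ (2 * n) := one_le_pow₀ hgt.le
    have h2 : sqInt v κ n ≤ (2 * C) ^ (2 * n) * sqInt v κ 0 ^ (2 * n + 1) := by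
      calc sqInt v κ n = 1 * sqInt v κ n := by ring
        _ ≤ (2 * C * y) ^ (2 * n) * sqInt v κ n := mul_le_mul_of_nonneg_right h1 e2
        _ = (2 * C) ^ (2 * n) * (y ^ (2 * n) * sqInt v κ n) := by ring
        _ = _ := by rw [hyE]
    have h3 : 2 * C * y * sqInt v κ n ≤
        2 * C * ((2 * C) ^ (2 * n) * sqInt v κ 0 ^ (2 * n + 1)) := by
      have : 2 * C * y ≤ 2 * C := by nlinarith
      gcongr
    have h4 : 2 * C * ((2 * C) ^ (2 * n) * sqInt v κ 0 ^ (2 * n + 1))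
        = (2 * C) ^ (2 * n + 1) * sqInt v κ 0 ^ (2 * n + 1) := by ring
    linarith

namespace IsGradientFlow

variable {m : ℕ} {e : Plane} {a d : ℝ} {T : EReal} {γ₀ : ℝ → Plane} {γ : ℝ → ℝ → Plane}

/-- Smallness of the scale-invariant energy is preserved. -/
lemma scaledEnergy_le (h : IsGradientFlow m e a d T γ₀ γ) (he : ‖e‖ = 1)
    (hω : windingNumber γ₀ = 0) {c : ℝ} (hc0 : 0 < c)
    (hc : ∀ (v : ℝ → ℝ) (κ : ℕ → ℝ → ℝ), ArcSystem v κ →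
      (wInt v fun _ => 1) ^ (2 * m + 1) * sqInt v κ m ≤ c →
      wInt v (polyEval κ (lengthRate m)) ≤ 0 ∧
      wInt v (polyEval κ (energyRate m m)) ≤ -sqInt v κ (m + (m + 2)))
    (h0 : length (fun y => γ y 0) ^ (2 * m + 1) * curvEnergy (fun y => γ y 0) m < c) {t : ℝ}
    (ht : t ∈ timeInterval T) :
    length (fun y => γ y t) ^ (2 * m + 1) * curvEnergy (fun y => γ y t) m ≤ c := by
  refine le_of_barrier (T := T)
    (f := fun t => length (fun y => γ y t) ^ (2 * m + 1) * curvEnergy (fun y => γ y t) m)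
    h.time_pos ((h.continuousOn_length.pow _).mul (h.continuousOn_sqInt m))
    (fun t ht h0 => ((h.hasDerivAt_length ht h0).pow (2 * m + 1)).mul (h.hasDerivAt_sqInt m ht h0))
    h0 (fun t ht h0 heq => ?_) t ht
  have hs := h.arcSystem he hω ht
  have hL := hs.length_pos
  obtain ⟨r1, r2⟩ := hc _ _ hs heq.le
  have heq' : (wInt (speed fun y => γ y t) fun _ => 1) ^ (2 * m + 1) *
    sqInt (speed fun y => γ y t) (curvDeriv fun y => γ y t) m = c := heq
  have hEm := hs.sqInt_nonneg m
  have hP := hs.sqInt_le_pow m (m + 2)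
  simp only [Pi.pow_apply, Nat.cast_add, Nat.cast_mul, Nat.cast_ofNat, Nat.cast_one,
    Nat.add_sub_cancel]
  set L := wInt (speed fun y => γ y t) fun _ => 1
  set E := sqInt (speed fun y => γ y t) (curvDeriv fun y => γ y t) m
  set E' := sqInt (speed fun y => γ y t) (curvDeriv fun y => γ y t) (m + (m + 2))
  -- At the positive level $c$ the energy is nonzero, so Poincaré makes the dissipation nonzero and
  -- the derivative strictly negative, as the barrier requires.
  have hE' : 0 < E' := by
    by_contra hcon
    have : E = 0 := le_antisymm (hP.trans
      (mul_nonpos_of_nonneg_of_nonpos (by positivity) (not_lt.1 hcon))) hEm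
    rw [this, mul_zero] at heq'
    linarith
  have t1 : (2 * (m : ℝ) + 1) * L ^ (2 * m) *
      wInt (speed fun y => γ y t) (polyEval (curvDeriv fun y => γ y t) (lengthRate m)) * E ≤ 0 :=
    mul_nonpos_of_nonpos_of_nonneg (mul_nonpos_of_nonneg_of_nonpos (by positivity) r1) hEm
  have t2 : L ^ (2 * m + 1) *
      wInt (speed fun y => γ y t) (polyEval (curvDeriv fun y => γ y t) (energyRate m m)) < 0 :=
    mul_neg_of_pos_of_neg (by positivity) (by linarith)
  exact add_neg_of_nonpos_of_neg t1 t2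

end IsGradientFlow

/-- Every energy decays exponentially along a flow with small scale-invariant energy. -/
lemma exists_energy_decay (m : ℕ) :
    ∃ c : ℝ, 0 < c ∧ ∀ (l : ℕ) (L₀ β E₀ Eₗ : ℝ), 0 < L₀ → β = (L₀ ^ (2 * (m + 2)))⁻¹ →
      ∃ K : ℝ, ∀ (e : Plane) (a d : ℝ) (γ₀ : ℝ → Plane) (T : EReal) (γ : ℝ → ℝ → Plane),
        ‖e‖ = 1 → windingNumber γ₀ = 0 → length γ₀ = L₀ → curvEnergy γ₀ m = E₀ →
        curvEnergy γ₀ l = Eₗ → L₀ ^ (2 * m + 1) * E₀ ≤ c → IsGradientFlow m e a d T γ₀ γ →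
        ∀ t ∈ timeInterval T, length (fun x => γ x t) ≤ L₀ ∧
          curvEnergy (fun x => γ x t) l ≤ K * Real.exp (-(β / 2) * t) := by
  obtain ⟨c, hc0, hc1, hc⟩ := exists_small_energy_rates m
  -- Halving the threshold makes the initial inequality strict for the barrier. It is chosen before
  -- `l`, so one constant serves all orders.
  refine ⟨c / 2, by positivity, fun l L₀ β E₀ Eₗ hL₀ hβ => ?_⟩
  obtain ⟨D, hD, hrate⟩ := exists_energyRate_le m l
  set A := D * (L₀ ^ (2 * m) * E₀) ^ (2 * (l + m + 2) + 1) with hA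
  refine ⟨Eₗ + A * (2 / β), fun e a d γ₀ T γ he hω hlen hE₀ hEₗ hsmall h => ?_⟩
  have hβ0 : 0 < β := by rw [hβ]; positivity
  have hcg := speed_curvDeriv_congr h.initial
  have hlen0 : length (fun y => γ y 0) = L₀ := by
    rw [← hlen]; exact wInt_congr hcg.1 fun _ _ => rfl
  have hen0 : ∀ i, curvEnergy (fun y => γ y 0) i = curvEnergy γ₀ i := fun i =>
    wInt_congr hcg.1 fun x hx => by rw [hcg.2 i x hx]
  have hG : ∀ t ∈ timeInterval T,
      length (fun y => γ y t) ^ (2 * m + 1) * curvEnergy (fun y => γ y t) m ≤ c :=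
    fun t ht => h.scaledEnergy_le he hω hc0 hc (by rw [hlen0, hen0, hE₀]; linarith) ht
  have hs := fun t (ht : t ∈ timeInterval T) => h.arcSystem he hω ht
  have hL : ∀ t ∈ timeInterval T, length (fun x => γ x t) ≤ L₀ := fun t ht => by
    rw [← hlen0]
    exact le_initial_of_hasDerivAt_nonpos h.continuousOn_length
      (fun t ht h0 => h.hasDerivAt_length ht h0)
      (fun t ht _ => (hc _ _ (hs t ht) (hG t ht)).1) ht
  have hP : ∀ i, ∀ t ∈ timeInterval T, β * curvEnergy (fun y => γ y t) i
      ≤ curvEnergy (fun y => γ y t) (i + (m + 2)) := fun i t ht => by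
    have h1 : curvEnergy (fun y => γ y t) i ≤ length (fun y => γ y t) ^ (2 * (m + 2)) *
      curvEnergy (fun y => γ y t) (i + (m + 2)) := (hs t ht).sqInt_le_pow i (m + 2)
    have h2 : length (fun y => γ y t) ^ (2 * (m + 2)) ≤ L₀ ^ (2 * (m + 2)) :=
      pow_le_pow_left₀ (hs t ht).length_pos.le (hL t ht) _
    have h3 := mul_le_mul_of_nonneg_right h2 ((hs t ht).sqInt_nonneg (i + (m + 2)))
    rw [hβ, inv_mul_le_iff₀ (by positivity)]
    exact h1.trans h3
  have hEm : ∀ t ∈ timeInterval T, curvEnergy (fun y => γ y t) m ≤ E₀ * Real.exp (-β * t) :=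
    fun t ht => by
      have h1 := le_mul_exp_of_deriv_le (A := 0) (β := β) (h.continuousOn_sqInt m)
        (fun t ht h0 => h.hasDerivAt_sqInt m ht h0) (fun t ht _ => by
          have h2 := (hc _ _ (hs t ht) (hG t ht)).2
          have h3 : β * sqInt (speed fun y => γ y t) (curvDeriv fun y => γ y t) m ≤
            sqInt (speed fun y => γ y t) (curvDeriv fun y => γ y t) (m + (m + 2)) := hP m t ht
          linarith) ht
      rw [zero_mul, add_zero] at h1
      refine h1.trans (le_of_eq ?_)
      rw [← hE₀, ← hen0]
      rfl
  have hE₀0 : 0 ≤ E₀ := by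
    rw [← hE₀, ← hen0]; exact (hs 0 h.zero_mem).sqInt_nonneg m
  have hE0 : ∀ t ∈ timeInterval T, curvEnergy (fun y => γ y t) 0 ≤
      L₀ ^ (2 * m) * E₀ * Real.exp (-β * t) := fun t ht => by
    have h1 : curvEnergy (fun y => γ y t) 0 ≤ length (fun y => γ y t) ^ (2 * m) *
      curvEnergy (fun y => γ y t) (0 + m) := (hs t ht).sqInt_le_pow 0 m
    rw [zero_add] at h1
    have h2 : length (fun y => γ y t) ^ (2 * m) ≤ L₀ ^ (2 * m) :=
      pow_le_pow_left₀ (hs t ht).length_pos.le (hL t ht) _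
    calc _ ≤ _ := h1
      _ ≤ L₀ ^ (2 * m) * (E₀ * Real.exp (-β * t)) :=
        mul_le_mul h2 (hEm t ht) ((hs t ht).sqInt_nonneg m) (by positivity)
      _ = _ := by ring
  intro t ht
  refine ⟨hL t ht, ?_⟩
  have hA0 : 0 ≤ A := by positivity
  have h1 := le_mul_exp_of_deriv_le (A := A) (β := β) (h.continuousOn_sqInt l)
    (fun t ht h0 => h.hasDerivAt_sqInt l ht h0) (fun t ht h0 => by
      have h2 := hrate _ _ (hs t ht) ((hG t ht).trans hc1)
      have h3 : β * sqInt (speed fun y => γ y t) (curvDeriv fun y => γ y t) l ≤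
        sqInt (speed fun y => γ y t) (curvDeriv fun y => γ y t) (l + (m + 2)) := hP l t ht
      have h4 : D * sqInt (speed fun y => γ y t) (curvDeriv fun y => γ y t) 0
          ^ (2 * (l + m + 2) + 1) ≤ A * Real.exp (-β * t) := by
        rw [hA, mul_assoc]
        refine mul_le_mul_of_nonneg_left ?_ hD
        refine (pow_le_pow_left₀ ((hs t ht).sqInt_nonneg 0) (hE0 t ht) _).trans ?_
        rw [mul_pow]
        refine mul_le_mul_of_nonneg_left ?_ (by positivity)
        -- The power of $E_0$ decays faster, but one factor $e^{-\beta t}$ suffices.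
        refine pow_le_of_le_one (Real.exp_pos _).le ?_ (by omega)
        rw [Real.exp_le_one_iff]
        nlinarith
      linarith) ht
  have h5 : sqInt (speed fun y => γ y 0) (curvDeriv fun y => γ y 0) l = Eₗ := by
    rw [← hEₗ, ← hen0]; rfl
  rw [h5] at h1
  have hEₗ0 : 0 ≤ Eₗ := by rw [← h5]; exact (hs 0 h.zero_mem).sqInt_nonneg l
  calc _ ≤ _ := h1
    _ = Eₗ * Real.exp (-β * t) + A * (t * Real.exp (-β * t)) := by ring
    _ ≤ Eₗ * Real.exp (-(β / 2) * t) + A * (2 / β * Real.exp (-(β / 2) * t)) := by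
      refine add_le_add (mul_le_mul_of_nonneg_left ?_ hEₗ0)
        (mul_le_mul_of_nonneg_left (mul_exp_neg_le hβ0) hA0)
      rw [Real.exp_le_exp]
      nlinarith [ht.1]
    _ = _ := by ring

end CurveFlow

theorem corollary4p6 (m : ℕ) :
    ∃ c : ℝ, 0 < c ∧ ∀ (ℓ : ℕ) (L₀ : ℝ), 0 < L₀ → ∃ δ : ℝ, 0 < δ ∧
      ∀ (e : CurveFlow.Plane) (a d : ℝ) (γ₀ : ℝ → CurveFlow.Plane),
        ‖e‖ = 1 → 0 < d →
        CurveFlow.IsNeumannCurve m e a d γ₀ →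
        CurveFlow.windingNumber γ₀ = 0 →
        CurveFlow.length γ₀ = L₀ →
        L₀ ^ (2 * m + 1) * CurveFlow.curvEnergy γ₀ m ≤ c →
        ∃ C : ℝ, ∀ (T : EReal) (γ : ℝ → ℝ → CurveFlow.Plane),
          CurveFlow.IsGradientFlow m e a d T γ₀ γ →
          ∀ t ∈ CurveFlow.timeInterval T,
            CurveFlow.curvEnergy (fun x => γ x t) ℓ ≤ C * Real.exp (-δ * t) ∧
            ∀ x ∈ CurveFlow.param,
              |CurveFlow.curvDeriv (fun y => γ y t) ℓ x| ≤ C * Real.exp (-δ * t) := by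
  obtain ⟨c, hc0, hc⟩ := CurveFlow.exists_energy_decay m
  -- The rate $\beta$ is halved once by the resonance and once more by the square root in the sup
  -- estimate.
  refine ⟨c, hc0, fun ℓ L₀ hL₀ => ⟨(L₀ ^ (2 * (m + 2)))⁻¹ / 4, by positivity, ?_⟩⟩
  intro e a d γ₀ he _ _ hω hlen hsmall
  set β := (L₀ ^ (2 * (m + 2)))⁻¹ with hβ
  have hβ0 : 0 < β := by positivity
  obtain ⟨K₁, h₁⟩ := hc ℓ L₀ β (CurveFlow.curvEnergy γ₀ m) (CurveFlow.curvEnergy γ₀ ℓ) hL₀ hβ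
  obtain ⟨K₂, h₂⟩ := hc (ℓ + 1) L₀ β (CurveFlow.curvEnergy γ₀ m)
    (CurveFlow.curvEnergy γ₀ (ℓ + 1)) hL₀ hβ
  -- $K_1$ bounds the energy of order $\ell$. The sup norm comes from $K_2$, the bound for order
  -- $\ell+1$, through $\kappa_\ell^2\le L_0E_{\ell+1}$. Both were fixed before $T$ and the
  -- solution.
  refine ⟨max |K₁| √(L₀ * |K₂|), fun T γ h t ht => ?_⟩
  obtain ⟨hL, e₁⟩ := h₁ e a d γ₀ T γ he hω hlen rfl rfl hsmall h t ht
  obtain ⟨-, e₂⟩ := h₂ e a d γ₀ T γ he hω hlen rfl rfl hsmall h t ht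
  have hs := h.arcSystem he hω ht
  have ht0 : 0 ≤ t := ht.1
  constructor
  · have hexp : Real.exp (-(β / 2) * t) ≤ Real.exp (-(β / 4) * t) := by
      rw [Real.exp_le_exp]; nlinarith
    calc _ ≤ _ := e₁
      _ ≤ |K₁| * Real.exp (-(β / 4) * t) :=
        mul_le_mul (le_abs_self _) hexp (Real.exp_pos _).le (abs_nonneg _)
      _ ≤ _ := mul_le_mul_of_nonneg_right (le_max_left _ _) (Real.exp_pos _).le
  · intro x hx
    have h3 : CurveFlow.curvDeriv (fun y => γ y t) ℓ x ^ 2 ≤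
        CurveFlow.length (fun y => γ y t) * CurveFlow.curvEnergy (fun y => γ y t) (ℓ + 1) :=
      hs.sq_le_length_mul ℓ hx
    have h4 : CurveFlow.curvDeriv (fun y => γ y t) ℓ x ^ 2 ≤
        (√(L₀ * |K₂|) * Real.exp (-(β / 4) * t)) ^ 2 := by
      rw [mul_pow, Real.sq_sqrt (by positivity), ← Real.exp_nat_mul]
      refine h3.trans ?_
      have h5 : CurveFlow.curvEnergy (fun y => γ y t) (ℓ + 1) ≤
          |K₂| * Real.exp (-(β / 2) * t) :=
        e₂.trans (mul_le_mul_of_nonneg_right (le_abs_self _) (Real.exp_pos _).le)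
      have h6 := mul_le_mul hL h5 (hs.sqInt_nonneg (ℓ + 1)) hL₀.le
      refine h6.trans (le_of_eq ?_)
      rw [← mul_assoc]
      congr 2
      push_cast
      ring
    refine (abs_le_of_sq_le_sq h4 (by positivity)).trans ?_
    exact mul_le_mul_of_nonneg_right (le_max_right _ _) (Real.exp_pos _).le
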